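/- Let $\mathfrak{gl}_\infty$ be the Lie algebra of complex matrices $(a_{ij})_{i,j\ge 1}$ with only finitely many nonzero entries, acting on $\mathbb{C}^\infty=\bigoplus_{i\ge 1}\mathbb{C}e_i$ by $E_{ij}e_k=\delta_{jk}e_i$. Let $\mathfrak{n}_+^\infty,\mathfrak{h}^\infty,\mathfrak{n}_-^\infty\subset\mathfrak{gl}_\infty$ be the subalgebras of strictly upper triangular, diagonal and strictly lower triangular matrices. Let $\lambda=(\lambda_1\ge\lambda_2\ge\dots)$ be a sequence of nonnegative integers that are eventually zero, identified with the Young diagram whose $i$-th row has $\lambda_i$ cells, and let $\lambda'_k$ be the length of its $k$-th column, $1\le k\le\lambda_1$. A filling $w=(v^{(k)}_i)_{1\le k\le\lambda_1,\,1\le i\le\lambda'_k}$ puts a vector of $\mathbb{C}^\infty$ in each cell ($i$-th cell of the $k$-th column). Put $$W^\lambda=\bigotimes_{k=1}^{\lambda_1}\textstyle\bigwedge^{\lambda'_k}\mathbb{C}^\infty,\qquad \Phi(w)=\bigotimes_{k=1}^{\lambda_1}\bigl(v^{(k)}_1\wedge\dots\wedge v^{(k)}_{\lambda'_k}\bigr)\in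 W^\lambda,$$ and let $U^\lambda\subset W^\lambda$ be the span of all differences $\Phi(w)-\sum_{w'}\Phi(w')$, where, for two fixed columns and a fixed set of $m$ cells in the right one of them, $w'$ runs over the fillings obtained from $w$ by exchanging the entries of these cells with those of an arbitrary set of $m$ cells of the left column, the vertical order being kept. The usual action of $\mathfrak{gl}_\infty$ on exterior powers and tensor products preserves $U^\lambda$; let $V^\lambda=W^\lambda/U^\lambda$ be the quotient representation, called the polynomial representation of $\mathfrak{gl}_\infty$, and let $$v_\lambda=\Bigl[\,\bigotimes_{k=1}^{\lambda_1}\bigl(e_1\wedge e_2\wedge\dots\wedge e_{\lambda'_k}\bigr)\Bigr]\in V^\lambda .$$ Lemma. The representation $V^\lambda$ is an irreducible representation of $\mathfrak{gl}_\infty$ with highest weight $\lambda$ and highest-weight vector $v_\lambda$. That is: 1. $v_\lambda\neq 0$ and $x\cdot v_\lambda=0$ for all $x\in\mathfrak{n}_+^\infty$; 2. $h\cdot v_\lambda=\bigl(\sum_i\lambda_i h_{ii}\bigr)v_\lambda$ for all $h\in\mathfrak{h}^\infty$, in particular $E_{ii}v_\lambda=\lambda_i v_\lambda$ for all $i$;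 3. $V^\lambda=U(\mathfrak{n}_-^\infty)\cdot v_\lambda$, i.e. the smallest $\mathfrak{n}_-^\infty$-stable subspace containing $v_\lambda$ is $V^\lambda$; 4. $V^\lambda\ne 0$, and its only $\mathfrak{gl}_\infty$-invariant subspaces are $0$ and $V^\lambda$. -/

import Mathlib

open scoped TensorProduct ExteriorAlgebra

noncomputable section

attribute [local instance 100] LieRing.ofAssociativeRing

namespace GLInf

/-- The tautological space `ℂ^∞ = ⨁ ⟨e_i⟩`. Indices start at `0`, so that the basis vector usually
called `e_{i+1}` is `e i`. -/
abbrev CInf : Type := ℕ →₀ ℂ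

/-- The basis vectors of `ℂ^∞`. -/
def e (i : ℕ) : CInf := Finsupp.single i 1

/-- The `(i, j)` entry of the infinite matrix of an endomorphism of `ℂ^∞`, which acts on columns,
so that the matrix unit `E_{ij}` sends `e_j` to `e_i`. -/
def entry (f : Module.End ℂ CInf) (i j : ℕ) : ℂ := f (e j) i

theorem apply_eq_sum (f : Module.End ℂ CInf) (v : CInf) (i : ℕ) :
    f v i = v.sum fun k c => c * entry f i k := by
  have h : v = v.sum fun k c => c • e k := by
    simp [e, Finsupp.sum_single]
  conv_lhs => rw [h]
  simp [Finsupp.sum, entry, map_sum, Finsupp.finsetSum_apply]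

theorem exists_entry_of_mul {f g : Module.End ℂ CInf} {i j : ℕ} (h : entry (f * g) i j ≠ 0) :
    ∃ k, entry f i k ≠ 0 ∧ entry g k j ≠ 0 := by
  have h1 : entry (f * g) i j = (g (e j)).sum fun k c => c * entry f i k :=
    apply_eq_sum f (g (e j)) i
  rw [h1, Finsupp.sum] at h
  obtain ⟨k, _, hk⟩ := Finset.exists_ne_zero_of_sum_ne_zero h
  exact ⟨k, right_ne_zero_of_mul hk, left_ne_zero_of_mul hk⟩

theorem entry_of_bracket {f g : Module.End ℂ CInf} {i j : ℕ} (h : entry ⁅f, g⁆ i j ≠ 0) :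
    (∃ k, entry f i k ≠ 0 ∧ entry g k j ≠ 0) ∨ (∃ k, entry g i k ≠ 0 ∧ entry f k j ≠ 0) := by
  have h1 : entry ⁅f, g⁆ i j = entry (f * g) i j - entry (g * f) i j := by
    simp [entry]
  by_cases h2 : entry (f * g) i j = 0
  · right
    apply exists_entry_of_mul
    intro h3
    exact h (by rw [h1, h2, h3, sub_zero])
  · exact Or.inl (exists_entry_of_mul h2)

theorem entry_add (f g : Module.End ℂ CInf) (i j : ℕ) :
    entry (f + g) i j = entry f i j + entry g i j := rfl

theorem entry_smul (c : ℂ) (f : Module.End ℂ CInf) (i j : ℕ) :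
    entry (c • f) i j = c * entry f i j := rfl

/-- The Lie algebra `𝔤𝔩_∞` of infinite complex matrices with only finitely many nonzero entries,
with the commutator bracket: the union of the `𝔤𝔩_n` embedded as upper left blocks. Matrices are
realised as endomorphisms of `ℂ^∞`, on which `𝔤𝔩_∞` acts tautologically. -/
def gl : LieSubalgebra ℂ (Module.End ℂ CInf) where
  carrier := {f | ∃ N : ℕ, ∀ i j, entry f i j ≠ 0 → i < N ∧ j < N}
  zero_mem' := ⟨0, fun i j h => (h rfl).elim⟩
  add_mem' := by
    rintro f g ⟨N, hN⟩ ⟨M, hM⟩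
    refine ⟨max N M, fun i j h => ?_⟩
    by_cases h1 : entry f i j = 0
    · have h2 : entry g i j ≠ 0 := fun h2 => h (by rw [entry_add, h1, h2, add_zero])
      have := hM i j h2
      omega
    · have := hN i j h1
      omega
  smul_mem' := by
    rintro c f ⟨N, hN⟩
    exact ⟨N, fun i j h => hN i j (right_ne_zero_of_mul (entry_smul c f i j ▸ h))⟩
  lie_mem' := by
    rintro f g ⟨N, hN⟩ ⟨M, hM⟩
    refine ⟨max N M, fun i j h => ?_⟩
    rcases entry_of_bracket h with ⟨k, h1, h2⟩ | ⟨k, h1, h2⟩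
    · have := hN _ _ h1
      have := hM _ _ h2
      omega
    · have := hM _ _ h1
      have := hN _ _ h2
      omega

/-- The Lie subalgebra of `𝔤𝔩_∞` of matrices all of whose nonzero entries are at positions `(i, j)`
with `r i j`, for a transitive relation `r`. -/
def glOn (r : ℕ → ℕ → Prop) (hr : ∀ i j k, r i j → r j k → r i k) : LieSubalgebra ℂ gl where
  carrier := {x | ∀ i j, entry x i j ≠ 0 → r i j}
  zero_mem' := fun i j h => (h rfl).elim
  add_mem' := by
    intro x y hx hy i j h
    by_cases h1 : entry x i j = 0
    · exact hy i j fun h2 => h (by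
        change entry ((x : Module.End ℂ CInf) + y) i j = 0
        rw [entry_add, h1, h2, add_zero])
    · exact hx i j h1
  smul_mem' := by
    intro c x hx i j h
    refine hx i j (right_ne_zero_of_mul (a := c) ?_)
    rw [← entry_smul]
    exact h
  lie_mem' := by
    intro x y hx hy i j h
    rw [LieSubalgebra.coe_bracket] at h
    rcases entry_of_bracket h with ⟨k, h1, h2⟩ | ⟨k, h1, h2⟩
    · exact hr _ _ _ (hx _ _ h1) (hy _ _ h2)
    · exact hr _ _ _ (hy _ _ h1) (hx _ _ h2)

/-- `𝔫₊^∞`, the strictly upper triangular matrices. -/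
def nPlus : LieSubalgebra ℂ gl := glOn (fun i j => i < j) fun _ _ _ => lt_trans

/-- `𝔫₋^∞`, the strictly lower triangular matrices. -/
def nMinus : LieSubalgebra ℂ gl := glOn (fun i j => j < i) fun _ _ _ h h' => lt_trans h' h

/-- `𝔥^∞`, the diagonal matrices. -/
def cartan : LieSubalgebra ℂ gl := glOn (fun i j => i = j) fun _ _ _ => Eq.trans

section Actions

variable {M : Type} [AddCommGroup M] [Module ℂ M]

/-- The alternating map `(v_1, …, v_n) ↦ ∑_i v_1 ∧ … ∧ g v_i ∧ … ∧ v_n`. -/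
def wedgeDerAlt (n : ℕ) (g : Module.End ℂ M) : M [⋀^Fin n]→ₗ[ℂ] ⋀[ℂ]^n M where
  toFun v := ∑ i, exteriorPower.ιMulti ℂ n (Function.update v i (g (v i)))
  map_update_add' := by
    intro inst v a x y
    obtain rfl : inst = fun p q => instDecidableEqFin n p q := Subsingleton.elim _ _
    rw [← Finset.sum_add_distrib]
    refine Finset.sum_congr rfl fun i _ => ?_
    rcases eq_or_ne i a with rfl | h
    · simp
    · rw [Function.update_of_ne h, Function.update_of_ne h, Function.update_of_ne h, Function.update_comm h.symm,
        Function.update_comm h.symm, Function.update_comm h.symm, AlternatingMap.map_update_add]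
  map_update_smul' := by
    intro inst v a c x
    obtain rfl : inst = fun p q => instDecidableEqFin n p q := Subsingleton.elim _ _
    rw [Finset.smul_sum]
    refine Finset.sum_congr rfl fun i _ => ?_
    rcases eq_or_ne i a with rfl | h
    · simp
    · rw [Function.update_of_ne h, Function.update_of_ne h, Function.update_comm h.symm,
        Function.update_comm h.symm, AlternatingMap.map_update_smul]
  map_eq_zero_of_eq' := by
    intro v a b hab hne
    rw [← Finset.add_sum_erase _ _ (Finset.mem_univ a),
      ← Finset.add_sum_erase _ _ (Finset.mem_erase.2 ⟨hne.symm, Finset.mem_univ b⟩), ← add_assoc]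
    have h1 : Function.update v b (g (v b)) =
        Function.update v a (g (v a)) ∘ Equiv.swap a b := by
      funext k
      rcases eq_or_ne k a with rfl | ha
      · simp [hne, Ne.symm hne, hab]
      · rcases eq_or_ne k b with rfl | hb
        · simp [hab]
        · simp [Equiv.swap_apply_of_ne_of_ne ha hb, ha, hb]
    rw [h1, AlternatingMap.map_swap _ _ hne, add_neg_cancel, zero_add]
    refine Finset.sum_eq_zero fun k hk => ?_
    simp only [Finset.mem_erase, Finset.mem_univ, and_true] at hk
    apply AlternatingMap.map_eq_zero_of_eq _ _ _ hne
    simp [Ne.symm hk.1, Ne.symm hk.2, hab]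

/-- The induced endomorphism `v_1 ∧ … ∧ v_n ↦ ∑_i v_1 ∧ … ∧ g v_i ∧ … ∧ v_n` of `⋀^n M`. -/
def wedgeDer (n : ℕ) (g : Module.End ℂ M) : Module.End ℂ (⋀[ℂ]^n M) :=
  exteriorPower.alternatingMapLinearEquiv (wedgeDerAlt n g)

theorem wedgeDer_ιMulti (n : ℕ) (g : Module.End ℂ M) (v : Fin n → M) :
    wedgeDer n g (exteriorPower.ιMulti ℂ n v) =
      ∑ i, exteriorPower.ιMulti ℂ n (Function.update v i (g (v i))) := by
  rw [wedgeDer, exteriorPower.alternatingMapLinearEquiv_apply_ιMulti]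
  rfl

/-- The usual action of the Lie algebra `End M` on `⋀^n M`. -/
def wedgeAction (n : ℕ) : Module.End ℂ M →ₗ⁅ℂ⁆ Module.End ℂ (⋀[ℂ]^n M) where
  toFun := wedgeDer n
  map_add' g h := by
    apply exteriorPower.linearMap_ext
    ext v
    simp [wedgeDer_ιMulti, Finset.sum_add_distrib]
  map_smul' c g := by
    apply exteriorPower.linearMap_ext
    ext v
    simp [wedgeDer_ιMulti, Finset.smul_sum]
  map_lie' := by
    intro g h
    apply exteriorPower.linearMap_ext
    ext1 v
    simp only [LinearMap.compAlternatingMap_apply, Ring.lie_def, LinearMap.sub_apply,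
      Module.End.mul_apply, wedgeDer_ιMulti, map_sum]
    have key : ∀ (p q : Module.End ℂ M) (i : Fin n),
        ∑ j, exteriorPower.ιMulti ℂ n (Function.update (Function.update v i (p (v i))) j
          (q (Function.update v i (p (v i)) j))) =
        exteriorPower.ιMulti ℂ n (Function.update v i (q (p (v i)))) +
        ∑ j ∈ Finset.univ.erase i, exteriorPower.ιMulti ℂ n
          (Function.update (Function.update v i (p (v i))) j (q (v j))) := by
      intro p q i
      rw [← Finset.add_sum_erase _ _ (Finset.mem_univ i)]
      congr 1
      · simp
      · refine Finset.sum_congr rfl fun j hj => ?_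
        rw [Function.update_of_ne (Finset.ne_of_mem_erase hj)]
    simp only [key, Finset.sum_add_distrib]
    have comm : ∑ i, ∑ j ∈ Finset.univ.erase i, exteriorPower.ιMulti ℂ n
          (Function.update (Function.update v i (h (v i))) j (g (v j))) =
        ∑ i, ∑ j ∈ Finset.univ.erase i, exteriorPower.ιMulti ℂ n
          (Function.update (Function.update v i (g (v i))) j (h (v j))) := by
      rw [Finset.sum_comm' (t' := Finset.univ) (s' := fun j => Finset.univ.erase j)]
      · refine Finset.sum_congr rfl fun i _ => Finset.sum_congr rfl fun j hj => ?_
        rw [Function.update_comm (Finset.ne_of_mem_erase hj)]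
      · intro x y
        simp [eq_comm]
    rw [comm, add_sub_add_right_eq_sub, ← Finset.sum_sub_distrib]
    refine Finset.sum_congr rfl fun i _ => ?_
    simp [sub_eq_add_neg, AlternatingMap.map_update_add, AlternatingMap.map_update_neg]

variable {ι : Type} [Fintype ι] [DecidableEq ι] {L : Type} [LieRing L] [LieAlgebra ℂ L]
  {T : ι → Type} [∀ k, AddCommGroup (T k)] [∀ k, Module ℂ (T k)]

/-- The usual action of a Lie algebra on a tensor product of representations:
`x (t_1 ⊗ … ⊗ t_n) = ∑_k t_1 ⊗ … ⊗ x t_k ⊗ … ⊗ t_n`. -/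
def tensorAction (ρ : ∀ k, L →ₗ⁅ℂ⁆ Module.End ℂ (T k)) :
    L →ₗ⁅ℂ⁆ Module.End ℂ (⨂[ℂ] k, T k) where
  toFun x := ∑ k, PiTensorProduct.map (Function.update (fun l => (1 : Module.End ℂ (T l))) k (ρ k x))
  map_add' x y := by
    simp [PiTensorProduct.map_update_add, Finset.sum_add_distrib]
  map_smul' c x := by
    simp [PiTensorProduct.map_update_smul, Finset.smul_sum]
  map_lie' := by
    intro x y
    simp only [sum_lie, lie_sum]
    refine Finset.sum_congr rfl fun k _ => ?_
    have mul : ∀ (k l : ι) (p : Module.End ℂ (T k)) (q : Module.End ℂ (T l)),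
        PiTensorProduct.map (Function.update (fun l => (1 : Module.End ℂ (T l))) k p) *
        PiTensorProduct.map (Function.update (fun l => (1 : Module.End ℂ (T l))) l q) =
        PiTensorProduct.map (fun m => Function.update (fun l => (1 : Module.End ℂ (T l))) k p m *
          Function.update (fun l => (1 : Module.End ℂ (T l))) l q m) :=
      fun k l p q => (PiTensorProduct.map_mul _ _).symm
    have same : ∀ (p q : Module.End ℂ (T k)),
        (fun m => Function.update (fun l => (1 : Module.End ℂ (T l))) k p m *
          Function.update (fun l => (1 : Module.End ℂ (T l))) k q m) =
        Function.update (fun l => (1 : Module.End ℂ (T l))) k (p * q) := by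
      intro p q
      funext m
      rcases eq_or_ne m k with rfl | h
      · simp
      · simp [h]
    rw [Finset.sum_eq_single k]
    · rw [LieHom.map_lie, Ring.lie_def, Ring.lie_def, mul, mul, same, same]
      exact (PiTensorProduct.mapMultilinear ℂ T T).map_update_sub _ k _ _
    · intro l _ hl
      rw [Ring.lie_def, mul, mul, sub_eq_zero]
      congr 1
      funext m
      rcases eq_or_ne m k with rfl | h
      · simp [Ne.symm hl]
      · simp [h]
    · simp

theorem tensorAction_tprod (ρ : ∀ k, L →ₗ⁅ℂ⁆ Module.End ℂ (T k)) (x : L) (t : ∀ k, T k) :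
    tensorAction ρ x (PiTensorProduct.tprod ℂ t) =
      ∑ k, PiTensorProduct.tprod ℂ (Function.update t k (ρ k x (t k))) := by
  change (∑ k, PiTensorProduct.map
    (Function.update (fun l => (1 : Module.End ℂ (T l))) k (ρ k x))) _ = _
  rw [LinearMap.sum_apply]
  refine Finset.sum_congr rfl fun k _ => ?_
  rw [PiTensorProduct.map_tprod]
  congr 1
  funext m
  rcases eq_or_ne m k with rfl | h
  · simp
  · simp [h]

end Actions

/-- The cells of a Young diagram, listed by columns: `⟨k, i⟩` is the `i`-th cell from the top in the
`k`-th column. -/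
abbrev Cell (lam : YoungDiagram) : Type :=
  Σ k : Fin (lam.rowLen 0), Fin (lam.colLen k)

/-- `(ℂ^∞)^{×λ}`: the fillings of the cells of the diagram by vectors. -/
abbrev Filling (lam : YoungDiagram) : Type := Cell lam → CInf

/-- The tensor product, over the columns of the diagram, of the exterior powers of `ℂ^∞` whose
degrees are the lengths of the columns. -/
def W (lam : YoungDiagram) : Type :=
  ⨂[ℂ] k : Fin (lam.rowLen 0), ⋀[ℂ]^(lam.colLen k) CInf

instance (lam : YoungDiagram) : AddCommGroup (W lam) :=
  inferInstanceAs (AddCommGroup (⨂[ℂ] k : Fin (lam.rowLen 0), ⋀[ℂ]^(lam.colLen k) CInf))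

instance (lam : YoungDiagram) : Module ℂ (W lam) :=
  inferInstanceAs (Module ℂ (⨂[ℂ] k : Fin (lam.rowLen 0), ⋀[ℂ]^(lam.colLen k) CInf))

/-- The representation of `𝔤𝔩_∞` on `W lam`. -/
def actionW (lam : YoungDiagram) : gl →ₗ⁅ℂ⁆ Module.End ℂ (W lam) :=
  tensorAction (T := fun k : Fin (lam.rowLen 0) => ⋀[ℂ]^(lam.colLen k) CInf)
    fun k => (wedgeAction (lam.colLen k)).comp gl.incl

instance (lam : YoungDiagram) : LieRingModule gl (W lam) :=
  LieRingModule.compLieHom (W lam) (actionW lam)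

instance (lam : YoungDiagram) : LieModule ℂ gl (W lam) :=
  LieModule.compLieHom (W lam) (actionW lam)

/-- The tensor product over the columns of the wedge products of the vectors in each column. -/
def wedges {lam : YoungDiagram} (w : Filling lam) : W lam :=
  PiTensorProduct.tprod ℂ fun k => exteriorPower.ιMulti ℂ (lam.colLen k) fun i => w ⟨k, i⟩

/-- The exchange, in order, of the cells `t 0 < … < t (m-1)` of the column `a` with the cells
`s 0 < … < s (m-1)` of the column `b`; all other cells are fixed. -/
def exchangeCell {lam : YoungDiagram} (a b : Fin (lam.rowLen 0)) {m : ℕ}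
    (t : Fin m ↪o Fin (lam.colLen a)) (s : Fin m ↪o Fin (lam.colLen b)) : Cell lam → Cell lam :=
  Function.extend (fun r => (⟨a, t r⟩ : Cell lam)) (fun r => ⟨b, s r⟩)
    (Function.extend (fun r => (⟨b, s r⟩ : Cell lam)) (fun r => ⟨a, t r⟩) id)

/-- `Φ(w) - ∑ Φ(w')`, where `w'` runs over the fillings obtained from `w` by exchanging the selected
cells `s 0 < … < s (m-1)` of the column `b` with any `m` cells of the column `a`, the vertical order
being kept. -/
def exchangeRel {lam : YoungDiagram} (a b : Fin (lam.rowLen 0)) {m : ℕ}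
    (s : Fin m ↪o Fin (lam.colLen b)) (w : Filling lam) : W lam :=
  wedges w - ∑ t : Fin m ↪o Fin (lam.colLen a), wedges (w ∘ exchangeCell a b t s)

theorem exchangeCell_involutive {lam : YoungDiagram} {a b : Fin (lam.rowLen 0)} (hab : a ≠ b)
    {m : ℕ} (t : Fin m ↪o Fin (lam.colLen a)) (s : Fin m ↪o Fin (lam.colLen b)) :
    Function.Involutive (exchangeCell a b t s) := by
  have hs : Function.Injective (fun r => (⟨b, s r⟩ : Cell lam)) := fun r r' h =>
    s.injective (by simpa using h)
  have ht : Function.Injective (fun r => (⟨a, t r⟩ : Cell lam)) := fun r r' h =>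
    t.injective (by simpa using h)
  have et : ∀ r, exchangeCell a b t s ⟨a, t r⟩ = ⟨b, s r⟩ := fun r => ht.extend_apply _ _ r
  have es : ∀ r, exchangeCell a b t s ⟨b, s r⟩ = ⟨a, t r⟩ := by
    intro r
    rw [exchangeCell, Function.extend_apply', hs.extend_apply]
    rintro ⟨r', h⟩
    exact hab (congrArg Sigma.fst h)
  intro c
  by_cases h1 : ∃ r, (⟨a, t r⟩ : Cell lam) = c
  · obtain ⟨r, rfl⟩ := h1
    rw [et, es]
  · by_cases h2 : ∃ r, (⟨b, s r⟩ : Cell lam) = c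
    · obtain ⟨r, rfl⟩ := h2
      rw [es, et]
    · have h3 : exchangeCell a b t s c = c := by
        rw [exchangeCell, Function.extend_apply' _ _ _ h1, Function.extend_apply' _ _ _ h2, id]
      rw [h3, h3]

theorem lie_wedges {lam : YoungDiagram} (x : gl) (w : Filling lam) :
    ⁅x, wedges w⁆ = ∑ c, wedges (Function.update w c ((x : Module.End ℂ CInf) (w c))) := by
  change tensorAction (T := fun k : Fin (lam.rowLen 0) => ⋀[ℂ]^(lam.colLen k) CInf)
    (fun k => (wedgeAction (lam.colLen k)).comp gl.incl) x (PiTensorProduct.tprod ℂ _) = _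
  rw [tensorAction_tprod, Fintype.sum_sigma]
  refine Finset.sum_congr rfl fun k _ => ?_
  have h1 : ((wedgeAction (lam.colLen k)).comp gl.incl) x
      (exteriorPower.ιMulti ℂ (lam.colLen k) fun i => w ⟨k, i⟩) =
      ∑ i, exteriorPower.ιMulti ℂ (lam.colLen k) (Function.update (fun i => w ⟨k, i⟩) i
        ((x : Module.End ℂ CInf) (w ⟨k, i⟩))) :=
    wedgeDer_ιMulti _ _ _
  rw [h1, MultilinearMap.map_update_sum]
  refine Finset.sum_congr rfl fun i _ => ?_
  rw [wedges]
  congr 1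
  funext l
  rcases eq_or_ne l k with rfl | h
  · rw [Function.update_self]
    congr 1
    funext j
    rcases eq_or_ne j i with rfl | h'
    · simp
    · rw [Function.update_of_ne h', Function.update_of_ne]
      simpa using h'
  · rw [Function.update_of_ne h]
    congr 1
    funext j
    rw [Function.update_of_ne]
    intro h'
    exact h (congrArg Sigma.fst h')

theorem lie_exchangeRel {lam : YoungDiagram} {a b : Fin (lam.rowLen 0)} (hab : a ≠ b) {m : ℕ}
    (s : Fin m ↪o Fin (lam.colLen b)) (w : Filling lam) (x : gl) :
    ⁅x, exchangeRel a b s w⁆ =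
      ∑ c, exchangeRel a b s (Function.update w c ((x : Module.End ℂ CInf) (w c))) := by
  simp only [exchangeRel, lie_sub, lie_sum, lie_wedges, Finset.sum_sub_distrib]
  congr 1
  conv_rhs => rw [Finset.sum_comm]
  refine Finset.sum_congr rfl fun t _ => ?_
  have inv := exchangeCell_involutive hab t s
  refine Fintype.sum_equiv inv.toPerm _ _ fun c => ?_
  congr 1
  funext d
  simp only [Function.Involutive.coe_toPerm, Function.comp_apply, Function.update_apply,
    inv.injective.eq_iff]

/-- The subspace `U^λ` of `W lam` spanned by the exchange relations between two columns `a < b` with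
selected cells in the right one, `b`; it is stable under `𝔤𝔩_∞`. -/
def U (lam : YoungDiagram) : LieSubmodule ℂ gl (W lam) where
  toSubmodule := Submodule.span ℂ {u | ∃ (a b : Fin (lam.rowLen 0)) (_ : a < b) (m : ℕ)
    (s : Fin m ↪o Fin (lam.colLen b)) (w : Filling lam), u = exchangeRel a b s w}
  lie_mem := by
    intro x u hu
    induction hu using Submodule.span_induction with
    | mem u hu =>
      obtain ⟨a, b, hab, m, s, w, rfl⟩ := hu
      rw [lie_exchangeRel hab.ne]
      exact Submodule.sum_mem _ fun c _ => Submodule.subset_span ⟨a, b, hab, m, s, _, rfl⟩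
    | zero => rw [lie_zero]; exact Submodule.zero_mem _
    | add u v _ _ hu hv => rw [lie_add]; exact Submodule.add_mem _ hu hv
    | smul c u _ hu => rw [lie_smul]; exact Submodule.smul_mem _ c hu

/-- The polynomial representation `V^λ` of `𝔤𝔩_∞`. -/
abbrev V (lam : YoungDiagram) : Type := W lam ⧸ U lam

/-- `v_λ = [⨂_k (e_1 ∧ e_2 ∧ … ∧ e_{λ'_k})]`, where `λ'_k` is the length of the `k`-th column. -/
def hwVector (lam : YoungDiagram) : V lam :=
  LieSubmodule.Quotient.mk (wedges fun c : Cell lam => e c.2)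

/-- `v` is a highest-weight vector, of weight `wt`, of the `𝔤𝔩_∞`-module `X`: it is nonzero, it is
killed by `𝔫₊`, the diagonal matrices act on it by `diag(h_1, h_2, …) ↦ ∑ wt_i h_i`, and the smallest
subspace that contains it and is stable under `𝔫₋`, that is `U(𝔫₋) v`, is the whole of `X`. -/
structure IsHighestWeightVector (X : Type) [AddCommGroup X] [Module ℂ X] [LieRingModule gl X]
    [LieModule ℂ gl X] (wt : ℕ → ℕ) (v : X) : Prop where
  ne_zero : v ≠ 0
  nPlus_lie : ∀ x ∈ nPlus, ⁅x, v⁆ = 0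
  cartan_lie : ∀ h ∈ cartan, ⁅h, v⁆ = (∑ᶠ i, (wt i : ℂ) * entry h i i) • v
  nMinus_span : LieSubmodule.lieSpan ℂ nMinus {v} = ⊤

end GLInf

end

open scoped TensorProduct ExteriorAlgebra

noncomputable section

attribute [local instance 100] LieRing.ofAssociativeRing

namespace GLInf

/-! ### Matrix units -/

/-! Everything rests on one claim about subquotients (`basisWedge_rowFilling_mem_sdiff`): if `A`,
`B` are submodules of `W lam` with `U lam ≤ A` and `B` not contained in `A`, then the wedge of the
row filling lies in `B` but not in `A`.

To see this, choose a weight vector in `B` outside `A` whose filling has minimal sum of entries.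
Raising operators lower this sum, so they send it into `A`; modulo `A` it is a highest-weight
vector, of some weight μ. Three facts force μ = λ. By sl₂-theory μ is weakly decreasing. Since
nonzero wedges have distinct entries in each column, μ is dominated by λ. Finally, the Casimir
operator of 𝔤𝔩_N acts on basis wedges by summing over all transpositions of cells, up to a scalar
multiple of the identity. Transpositions within a column give signs and those between columns are
controlled by the one-cell exchange relations, so modulo `U lam` the Casimir operator is a scalar
(`exists_casimir_sub_mem_U`). Its value on highest-weight vectors separates λ from any smaller
partition (`sum_range_eq_of_casimirValue_eq`). The λ-weight space of `W lam` is the line through the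
row filling, which gives the claim.

That the row filling is nonzero modulo `U lam` is shown by a functional, the product of the leading
minors of the columns. It kills the exchange relations by a Sylvester-type determinant identity
(`det_mul_eq_sum`). Irreducibility follows by using the claim twice, once below and once above a
given submodule. Generation under 𝔫₋ then follows because U(𝔫₋)v is stable under all of 𝔤𝔩_∞. -/

theorem entry_single_comp_apply (i j k l : ℕ) :
    entry ((Finsupp.lsingle i).comp (Finsupp.lapply j)) k l = if k = i ∧ l = j then 1 else 0 := by
  simp only [entry, e, LinearMap.comp_apply, Finsupp.lapply_apply, Finsupp.lsingle_apply,
    Finsupp.single_apply]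
  grind

/-- The matrix unit `E_{ij}`, which sends `e j` to `e i`. -/
def E (i j : ℕ) : gl :=
  ⟨(Finsupp.lsingle i).comp (Finsupp.lapply j), i + j + 1, fun k l h => by
    rw [entry_single_comp_apply] at h
    have := (ite_ne_right_iff.1 h).1
    omega⟩

theorem entry_E (i j k l : ℕ) :
    entry (E i j : Module.End ℂ CInf) k l = if k = i ∧ l = j then 1 else 0 :=
  entry_single_comp_apply i j k l

theorem E_apply_e (i j k : ℕ) :
    (E i j : Module.End ℂ CInf) (e k) = if k = j then e i else 0 := by
  change Finsupp.single i ((e k) j) = _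
  simp only [e, Finsupp.single_apply]
  split_ifs <;> simp

theorem end_ext {f g : Module.End ℂ CInf} (h : ∀ k, f (e k) = g (e k)) : f = g :=
  Finsupp.lhom_ext' fun k => LinearMap.ext_ring (h k)

theorem E_lie_E (i j k l : ℕ) :
    ⁅E i j, E k l⁆ = (if j = k then E i l else 0) - if l = i then E k j else 0 := by
  apply Subtype.ext
  apply end_ext
  intro p
  rw [LieSubalgebra.coe_bracket, Ring.lie_def]
  rw [LinearMap.sub_apply, Module.End.mul_apply, Module.End.mul_apply, E_apply_e, E_apply_e]
  have key : ∀ (i j k : ℕ) (P : Prop) [Decidable P],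
      (E i j : Module.End ℂ CInf) (if P then e k else 0) = if P ∧ k = j then e i else 0 := by
    intro i j k P _
    split_ifs <;> simp_all [E_apply_e]
  have key' : ∀ (i j : ℕ) (P : Prop) [Decidable P],
      ((if P then E i j else 0 : gl) : Module.End ℂ CInf) (e p) =
        if P ∧ p = j then e i else 0 := by
    intro i j P _
    split_ifs <;> simp_all [E_apply_e]
  rw [key, key]
  refine Eq.trans ?_ (congrArg₂ (· - ·) (key' i l (j = k)) (key' k j (l = i))).symm
  congr 1 <;> congr 1 <;> simp only [eq_iff_iff] <;> tauto

theorem eq_sum_E {x : gl} {N : ℕ} (hN : ∀ i j, entry x i j ≠ 0 → i < N ∧ j < N) :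
    x = ∑ i ∈ Finset.range N, ∑ j ∈ Finset.range N, entry x i j • E i j := by
  apply Subtype.ext
  apply end_ext
  intro l
  ext k
  have h : ∀ y : gl, (y : Module.End ℂ CInf) (e l) k = entry y k l := fun _ => rfl
  have h' : ∀ (c : ℂ) (y : gl), entry (c • y : gl) k l = c * entry y k l := fun _ _ => rfl
  simp only [AddSubmonoidClass.coe_finsetSum, LinearMap.sum_apply,
    Finsupp.finsetSum_apply, h, h', entry_E,
    mul_ite, mul_one, mul_zero, ite_and, Finset.sum_ite_irrel, Finset.sum_ite_eq,
    Finset.sum_const_zero, Finset.mem_range]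
  by_cases h0 : entry x k l = 0
  · simp [h0]
  · simp [hN k l h0]

/-! ### Wedges of basis vectors -/

section

variable {lam : YoungDiagram}

theorem wedges_eq_zero_of_eq {w : Filling lam} {k : Fin (lam.rowLen 0)}
    {i j : Fin (lam.colLen k)} (hij : i ≠ j) (h : w ⟨k, i⟩ = w ⟨k, j⟩) : wedges w = 0 :=
  (PiTensorProduct.tprod ℂ).map_coord_zero k <|
    (exteriorPower.ιMulti ℂ (lam.colLen k)).map_eq_zero_of_eq _ h hij

theorem wedges_eq_zero_of_eq_zero {w : Filling lam} {c : Cell lam} (h : w c = 0) :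
    wedges w = 0 :=
  (PiTensorProduct.tprod ℂ).map_coord_zero c.1 <|
    (exteriorPower.ιMulti ℂ (lam.colLen c.1)).map_coord_zero c.2 h

theorem wedges_comp_perm (w : Filling lam) 
    (σ : ∀ k : Fin (lam.rowLen 0), Equiv.Perm (Fin (lam.colLen k))) :
    wedges (fun c => w ⟨c.1, σ c.1 c.2⟩) =
      (∏ k, (((σ k).sign : ℤ) : ℂ)) • wedges w := by
  have h : (fun k : Fin (lam.rowLen 0) =>
        exteriorPower.ιMulti ℂ (lam.colLen k) fun i => w ⟨k, σ k i⟩) =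
      fun k : Fin (lam.rowLen 0) => (((σ k).sign : ℤ) : ℂ) •
        exteriorPower.ιMulti ℂ (lam.colLen k) fun i => w ⟨k, i⟩ := by
    funext k
    have := (exteriorPower.ιMulti ℂ (lam.colLen k)).map_perm (fun i => w ⟨k, i⟩) (σ k)
    rw [Units.smul_def, ← Int.cast_smul_eq_zsmul ℂ] at this
    exact this
  change PiTensorProduct.tprod ℂ (fun k : Fin (lam.rowLen 0) =>
    exteriorPower.ιMulti ℂ (lam.colLen k) fun i => w ⟨k, σ k i⟩) = _
  rw [h]
  exact (PiTensorProduct.tprod ℂ).map_smul_univ _ _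

theorem wedges_swap (w : Filling lam) {k : Fin (lam.rowLen 0)}
    {i j : Fin (lam.colLen k)} (hij : i ≠ j) :
    wedges (w ∘ Equiv.swap ⟨k, i⟩ ⟨k, j⟩) = - wedges w := by
  have h := wedges_comp_perm w (Function.update (fun _ => 1) k (Equiv.swap i j))
  rw [Finset.prod_eq_single k (fun l _ hl => by simp [hl]) (by simp)] at h
  simp only [Function.update_self, Equiv.Perm.sign_swap hij] at h
  simp only [Units.val_neg, Units.val_one, Int.cast_neg, Int.cast_one, neg_smul, one_smul] at h
  rw [← h]
  congr 1
  funext ⟨l, a⟩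
  rcases eq_or_ne l k with rfl | hl
  · simp only [Function.comp_apply, Function.update_self, Equiv.swap_apply_def, Sigma.mk.injEq,
      heq_eq_eq, true_and]
    split_ifs <;> rfl
  · rw [Function.comp_apply, Equiv.swap_apply_of_ne_of_ne] <;> simp [hl]

/-- The wedge product attached to a filling by basis vectors, given by their indices. -/
def basisWedge (w : Cell lam → ℕ) : W lam := wedges fun c => e (w c)

theorem E_lie_basisWedge (i j : ℕ) (w : Cell lam → ℕ) :
    ⁅E i j, basisWedge w⁆ =
      ∑ c, if w c = j then basisWedge (Function.update w c i) else 0 := by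
  rw [basisWedge, lie_wedges]
  refine Finset.sum_congr rfl fun c _ => ?_
  rw [E_apply_e]
  split_ifs with h
  · rw [basisWedge]
    congr 1
    funext d
    rcases eq_or_ne d c with rfl | hd
    · simp
    · simp [hd]
  · exact wedges_eq_zero_of_eq_zero (c := c) (by simp)

theorem injective_of_basisWedge_ne_zero {w : Cell lam → ℕ} (h : basisWedge w ≠ 0)
    (k : Fin (lam.rowLen 0)) : Function.Injective fun i => w ⟨k, i⟩ := by
  intro i j hij
  by_contra hne
  exact h (wedges_eq_zero_of_eq hne (congrArg e hij))

variable (lam) in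
theorem span_basisWedge : Submodule.span ℂ (Set.range (basisWedge (lam := lam))) = ⊤ := by
  set S := Submodule.span ℂ (Set.range (basisWedge (lam := lam)))
  let b : Module.Basis ℕ ℂ CInf := Finsupp.basisSingleOne
  -- The quotient map by `S` vanishes as soon as it does on tensors of basis vectors of the exterior
  -- powers, and these are basis wedges with increasing columns.
  have key : S.mkQ.compMultilinearMap (PiTensorProduct.tprod ℂ
      (s := fun k : Fin (lam.rowLen 0) => ⋀[ℂ]^(lam.colLen k) CInf)) = 0 := by
    refine Module.Basis.ext_multilinear (fun k => b.exteriorPower (lam.colLen k)) fun v => ?_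
    refine (Submodule.Quotient.mk_eq_zero S).2 (Submodule.subset_span
      ⟨fun c => Set.powersetCard.ofFinEmbEquiv.symm (v c.1) c.2, ?_⟩)
    rw [basisWedge, wedges]
    congr 1
    funext k
    rw [exteriorPower.basis_apply]
    simp [exteriorPower.ιMulti_family, b, e, Function.comp_def]
  have : S.mkQ = 0 := PiTensorProduct.ext key
  rw [← S.ker_mkQ, this, LinearMap.ker_zero]

end

/-! ### A generalisation of Cramer's rule -/

section

variable {α β M : Type}

theorem extend_update [DecidableEq α] [DecidableEq β] {t : α → β} (ht : t.Injective)
    (x : α → M) (v : β → M) (r : α) (y : M) :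
    Function.extend t (Function.update x r y) v =
      Function.update (Function.extend t x v) (t r) y := by
  funext j
  by_cases hj : ∃ r', t r' = j
  · obtain ⟨r', rfl⟩ := hj
    rw [ht.extend_apply]
    rcases eq_or_ne r' r with rfl | h
    · simp
    · rw [Function.update_of_ne h, Function.update_of_ne (ht.ne h), ht.extend_apply]
  · rw [Function.extend_apply' _ _ _ hj, Function.update_of_ne, Function.extend_apply' _ _ _ hj]
    rintro rfl
    exact hj ⟨r, rfl⟩

variable [AddCommGroup M] [Module ℂ M]

theorem alternatingMap_sum_apply {ι : Type} (s : Finset ι) (f : ι → M [⋀^α]→ₗ[ℂ] ℂ) (x : α → M) :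
    (∑ i ∈ s, f i) x = ∑ i ∈ s, f i x := by
  classical
  induction s using Finset.induction_on with
  | empty => simp
  | insert i s hi ih => rw [Finset.sum_insert hi, Finset.sum_insert hi, AlternatingMap.add_apply, ih]

/-- An alternating map as a function of the arguments selected by `t`, with the other arguments
fixed. -/
def extendAlt (f : M [⋀^β]→ₗ[ℂ] ℂ) (t : α ↪ β) (v : β → M) : M [⋀^α]→ₗ[ℂ] ℂ where
  toFun x := f (Function.extend t x v)
  map_update_add' := by
    intro inst x r y z
    classical
    simp only [extend_update t.injective, f.map_update_add]
  map_update_smul' := by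
    intro inst x r c y
    classical
    simp only [extend_update t.injective, f.map_update_smul]
  map_eq_zero_of_eq' x r r' h hne :=
    f.map_eq_zero_of_eq _ (by simpa [t.injective.extend_apply] using h) (t.injective.ne hne)

end

theorem orderEmbedding_eq_of_forall_mem_range {m p : ℕ} {t t' : Fin m ↪o Fin p}
    (h : ∀ r, t' r ∈ Set.range t) : t' = t := by
  have : Set.range t' = Set.range t := by
    refine Set.eq_of_subset_of_ncard_le (by rintro _ ⟨r, rfl⟩; exact h r) ?_ (Set.toFinite _)
    rw [← Set.image_univ, ← Set.image_univ, Set.ncard_image_of_injective _ t.injective,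
      Set.ncard_image_of_injective _ t'.injective]
  exact OrderEmbedding.range_inj.1 this

/-- Both sides are alternating in `x`, and the rows of `v` form a basis, so it is enough to take for
`x` an increasing selection `t'` of these rows. Then only the term `t = t'` survives. -/
theorem det_mul_eq_sum_of_det_ne_zero {m p : ℕ} (g : (Fin p → ℂ) [⋀^Fin m]→ₗ[ℂ] ℂ)
    (x : Fin m → Fin p → ℂ) (v : Fin p → Fin p → ℂ) (hv : (Matrix.of v).det ≠ 0) :
    (Matrix.of v).det * g x = ∑ t : Fin m ↪o Fin p,
      (Matrix.of (Function.extend t x v)).det * g (v ∘ t) := by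
  have hli : LinearIndependent ℂ v := by
    have := Matrix.linearIndependent_rows_of_det_ne_zero hv
    exact this
  let b : Module.Basis (Fin p) ℂ (Fin p → ℂ) :=
    basisOfLinearIndependentOfCardEqFinrank' v hli (by simp)
  have hb : ∀ i, b i = v i := fun i => by simp [b]
  suffices h : (Matrix.of v).det • g = ∑ t : Fin m ↪o Fin p,
      g (v ∘ t) • extendAlt (Matrix.detRowAlternating (n := Fin p) (R := ℂ)) t.toEmbedding v by
    have := congrArg (fun f => f x) h
    simp only [AlternatingMap.smul_apply, alternatingMap_sum_apply, smul_eq_mul] at this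
    rw [this]
    exact Finset.sum_congr rfl fun t _ => mul_comm _ _
  apply (exteriorPower.alternatingMapLinearEquiv (R := ℂ)).injective
  refine (b.exteriorPower m).ext fun s => ?_
  rw [exteriorPower.basis_apply, exteriorPower.ιMulti_family,
    exteriorPower.alternatingMapLinearEquiv_apply_ιMulti,
    exteriorPower.alternatingMapLinearEquiv_apply_ιMulti]
  set t' := Set.powersetCard.ofFinEmbEquiv.symm s
  have hbv : (b ∘ t' : Fin m → Fin p → ℂ) = v ∘ t' := funext fun i => hb _
  rw [hbv]
  simp only [AlternatingMap.smul_apply, alternatingMap_sum_apply, smul_eq_mul]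
  rw [Finset.sum_eq_single t']
  · rw [mul_comm]
    congr 1
    change _ = (Matrix.of _).det
    congr 2
    funext j
    by_cases hj : ∃ r, t' r = j
    · obtain ⟨r, rfl⟩ := hj
      exact (t'.injective.extend_apply (v ∘ t') v r).symm
    · exact (Function.extend_apply' _ _ _ hj).symm
  · intro t _ ht
    -- For such an `r`, the row `v (t' r)` appears twice: at its own place, which is not
    -- overwritten, and at place `t r`.
    have : ∃ r, t' r ∉ Set.range t := by
      by_contra! h
      exact ht (orderEmbedding_eq_of_forall_mem_range h).symm
    obtain ⟨r, hr⟩ := this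
    refine mul_eq_zero_of_right _ ?_
    refine (Matrix.detRowAlternating (n := Fin p) (R := ℂ)).map_eq_zero_of_eq
      (Function.extend t (v ∘ t') v) (i := t r) (j := t' r) ?_ ?_
    · exact (t.injective.extend_apply (v ∘ t') v r).trans
        (Function.extend_apply' (v ∘ t') v (t' r) hr).symm
    · exact fun h => hr ⟨r, h⟩
  · simp

/-- Cramer's rule is the case `m = 1`. -/
theorem det_mul_eq_sum {m p : ℕ} (g : (Fin p → ℂ) [⋀^Fin m]→ₗ[ℂ] ℂ) (hg : Continuous g)
    (x : Fin m → Fin p → ℂ) (v : Fin p → Fin p → ℂ) :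
    (Matrix.of v).det * g x = ∑ t : Fin m ↪o Fin p,
      (Matrix.of (Function.extend t x v)).det * g (v ∘ t) := by
  -- The singular case is a limit: `v + ε·1` is invertible unless ε is a root of the characteristic
  -- polynomial of `-v`, and both sides are continuous in ε.
  let V : ℂ → Fin p → Fin p → ℂ := fun ε i j => v i j + ε * (1 : Matrix (Fin p) (Fin p) ℂ) i j
  have hV : Continuous V := by fun_prop
  have hfin : {ε : ℂ | (Matrix.of (V ε)).det = 0}.Finite := by
    have h0 := (Matrix.charpoly_monic (-Matrix.of v)).ne_zero
    refine (Polynomial.finite_setOfPred_isRoot h0).subset fun ε hε => ?_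
    rw [Set.mem_ofPred_eq, Polynomial.IsRoot, Matrix.eval_charpoly, ← hε]
    congr 1
    ext i j
    simp [V, Matrix.one_apply, Matrix.scalar_apply, Matrix.diagonal_apply, add_comm]
  have hd : Dense {ε : ℂ | (Matrix.of (V ε)).det = 0}ᶜ := hfin.countable.dense_compl ℂ
  have key : (fun ε => (Matrix.of (V ε)).det * g x) = fun ε => ∑ t : Fin m ↪o Fin p,
      (Matrix.of (Function.extend t x (V ε))).det * g (V ε ∘ t) := by
    refine Continuous.ext_on hd ?_ ?_ fun ε hε => det_mul_eq_sum_of_det_ne_zero g x (V ε) hε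
    · exact (Continuous.matrix_det hV).mul continuous_const
    · refine continuous_finsetSum _ fun t _ => (Continuous.matrix_det ?_).mul (hg.comp ?_)
      · refine continuous_pi fun j => ?_
        change Continuous fun ε => Function.extend t x (V ε) j
        by_cases hj : ∃ r, t r = j
        · obtain ⟨r, rfl⟩ := hj
          simp only [t.injective.extend_apply]
          exact continuous_const
        · simp only [Function.extend_apply' _ _ _ hj]
          exact (continuous_apply j).comp hV
      · exact continuous_pi fun r => (continuous_apply (t r)).comp hV
  have h0 : V 0 = v := by
    funext i j
    simp [V]
  have := congrFun key 0
  simpa only [h0] using this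

/-! ### The product of the leading minors of the columns -/

/-- The first `n` coordinates of a vector. -/
def truncate (n : ℕ) : CInf →ₗ[ℂ] (Fin n → ℂ) := LinearMap.pi fun i => Finsupp.lapply (i : ℕ)

/-- The leading `n × n` minor of `n` vectors. -/
def leadingMinor (n : ℕ) : CInf [⋀^Fin n]→ₗ[ℂ] ℂ :=
  Matrix.detRowAlternating.compLinearMap (truncate n)

theorem leadingMinor_e (n : ℕ) : leadingMinor n (fun i => e i) = 1 := by
  change (Matrix.of fun i : Fin n => truncate n (e i)).det = 1
  have : (Matrix.of fun i : Fin n => truncate n (e i)) = 1 := by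
    ext i j
    simp [truncate, e, Finsupp.single_apply, Matrix.one_apply, Fin.ext_iff]
  rw [this, Matrix.det_one]

/-- The determinant identity applies with `g` the smaller minor as a function of the vectors in the
places `s`. Since `q ≤ p`, this minor depends only on the first `p` coordinates; this is where the
left column must be the longer one. -/
theorem leadingMinor_mul_eq_sum {m p q : ℕ} (hqp : q ≤ p) (s : Fin m ↪o Fin q)
    (v : Fin p → CInf) (u : Fin q → CInf) :
    leadingMinor p v * leadingMinor q u = ∑ t : Fin m ↪o Fin p,
      leadingMinor p (Function.extend t (u ∘ s) v) *
        leadingMinor q (Function.extend s (v ∘ t) u) := by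
  let res : (Fin p → ℂ) →ₗ[ℂ] (Fin q → ℂ) := LinearMap.funLeft ℂ ℂ (Fin.castLE hqp)
  let g : (Fin p → ℂ) [⋀^Fin m]→ₗ[ℂ] ℂ :=
    extendAlt (Matrix.detRowAlternating.compLinearMap res) s.toEmbedding (truncate p ∘ u)
  have hext : ∀ {n k : ℕ} (t : Fin m ↪o Fin k) (y : Fin m → CInf) (z : Fin k → CInf),
      Function.extend t (truncate n ∘ y) (truncate n ∘ z) = truncate n ∘ Function.extend t y z := by
    intro n k t y z
    funext j
    by_cases hj : ∃ r, t r = j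
    · obtain ⟨r, rfl⟩ := hj
      simp [t.injective.extend_apply]
    · simp [Function.extend_apply' _ _ _ hj]
  have hg' : ∀ y : Fin m → CInf,
      g (truncate p ∘ y) = leadingMinor q (Function.extend s y u) := by
    intro y
    change (Matrix.detRowAlternating.compLinearMap res)
      (Function.extend s (truncate p ∘ y) (truncate p ∘ u)) = _
    rw [hext]
    rfl
  have hg : Continuous g := by
    change Continuous fun y => (Matrix.of fun i =>
      res (Function.extend s y (truncate p ∘ u) i)).det
    refine Continuous.matrix_det (continuous_pi fun i => ?_)
    change Continuous fun y => fun j => Function.extend s y (truncate p ∘ u) i (Fin.castLE hqp j)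
    by_cases hi : ∃ r, s r = i
    · obtain ⟨r, rfl⟩ := hi
      simp only [s.injective.extend_apply]
      fun_prop
    · simp only [Function.extend_apply' _ _ _ hi]
      exact continuous_const
  have hu : Function.extend s (u ∘ s) u = u := by
    funext j
    by_cases hj : ∃ r, s r = j
    · obtain ⟨r, rfl⟩ := hj
      simp [s.injective.extend_apply]
    · simp [Function.extend_apply' _ _ _ hj]
  have key := det_mul_eq_sum g hg (truncate p ∘ u ∘ s) (truncate p ∘ v)
  rw [hg', hu] at key
  refine key.trans (Finset.sum_congr rfl fun t _ => ?_)
  rw [hext, Function.comp_assoc, hg']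
  rfl

section

variable {lam : YoungDiagram}

variable (lam) in
/-- The product over the columns of the leading minors. -/
def minorProd : W lam →ₗ[ℂ] ℂ :=
  PiTensorProduct.lift ((MultilinearMap.mkPiAlgebra ℂ (Fin (lam.rowLen 0)) ℂ).compLinearMap
    fun k => exteriorPower.alternatingMapLinearEquiv (leadingMinor (lam.colLen k)))

theorem minorProd_wedges (w : Filling lam) :
    minorProd lam (wedges w) = ∏ k : Fin (lam.rowLen 0),
      leadingMinor (lam.colLen k) fun i => w ⟨k, i⟩ := by
  refine (PiTensorProduct.lift.tprod _).trans ?_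
  rw [MultilinearMap.compLinearMap_apply, MultilinearMap.mkPiAlgebra_apply]
  refine Finset.prod_congr rfl fun k _ => ?_
  rw [exteriorPower.alternatingMapLinearEquiv_apply_ιMulti]

variable {a b : Fin (lam.rowLen 0)} {m : ℕ} (t : Fin m ↪o Fin (lam.colLen a))
  (s : Fin m ↪o Fin (lam.colLen b))

theorem exchangeCell_left (j : Fin (lam.colLen a)) (w : Filling lam) (hab : a ≠ b) :
    w (exchangeCell a b t s ⟨a, j⟩) =
      Function.extend t (fun r => w ⟨b, s r⟩) (fun i => w ⟨a, i⟩) j := by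
  have ht : Function.Injective (fun r => (⟨a, t r⟩ : Cell lam)) := fun r r' h =>
    t.injective (by simpa using h)
  by_cases hj : ∃ r, t r = j
  · obtain ⟨r, rfl⟩ := hj
    rw [t.injective.extend_apply, exchangeCell, ht.extend_apply (a := r)]
  · rw [Function.extend_apply' _ _ _ hj, exchangeCell, Function.extend_apply',
      Function.extend_apply', id]
    · rintro ⟨r, h⟩
      exact hab (congrArg Sigma.fst h).symm
    · rintro ⟨r, h⟩
      exact hj ⟨r, by simpa using h⟩

theorem exchangeCell_right (j : Fin (lam.colLen b)) (w : Filling lam) (hab : a ≠ b) :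
    w (exchangeCell a b t s ⟨b, j⟩) =
      Function.extend s (fun r => w ⟨a, t r⟩) (fun i => w ⟨b, i⟩) j := by
  have hs : Function.Injective (fun r => (⟨b, s r⟩ : Cell lam)) := fun r r' h =>
    s.injective (by simpa using h)
  have hn : ¬ ∃ r, (⟨a, t r⟩ : Cell lam) = ⟨b, j⟩ := by
    rintro ⟨r, h⟩
    exact hab (congrArg Sigma.fst h)
  rw [exchangeCell, Function.extend_apply' _ _ _ hn]
  by_cases hj : ∃ r, s r = j
  · obtain ⟨r, rfl⟩ := hj
    rw [s.injective.extend_apply, hs.extend_apply (a := r)]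
  · rw [Function.extend_apply' _ _ _ hj, Function.extend_apply', id]
    rintro ⟨r, h⟩
    exact hj ⟨r, by simpa using h⟩

theorem exchangeCell_of_ne {c : Cell lam} (ha : c.1 ≠ a) (hb : c.1 ≠ b) :
    exchangeCell a b t s c = c := by
  rw [exchangeCell, Function.extend_apply', Function.extend_apply', id]
  · rintro ⟨r, rfl⟩
    exact hb rfl
  · rintro ⟨r, rfl⟩
    exact ha rfl

/-- The columns other than `a` and `b` contribute a common factor, so the two-column identity
suffices. This is the only place that needs the relations for every `m`. -/
theorem minorProd_exchangeRel (hab : a < b) (w : Filling lam) :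
    minorProd lam (exchangeRel a b s w) = 0 := by
  have hb : b ∈ Finset.univ.erase a := Finset.mem_erase.2 ⟨hab.ne', Finset.mem_univ b⟩
  have split : ∀ w : Filling lam, minorProd lam (wedges w) =
      (leadingMinor (lam.colLen a) (fun i => w ⟨a, i⟩) *
        leadingMinor (lam.colLen b) fun i => w ⟨b, i⟩) *
        ∏ k ∈ (Finset.univ.erase a).erase b, leadingMinor (lam.colLen k) fun i => w ⟨k, i⟩ := by
    intro w
    rw [minorProd_wedges, ← Finset.mul_prod_erase _ _ (Finset.mem_univ a),
      ← Finset.mul_prod_erase _ _ hb, mul_assoc]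
  rw [exchangeRel, map_sub, map_sum, sub_eq_zero, split,
    leadingMinor_mul_eq_sum (lam.colLen_anti a b hab.le) s, Finset.sum_mul]
  refine Finset.sum_congr rfl fun t _ => ?_
  rw [split]
  congr 1
  · congr 1
    · congr 1
      funext j
      exact (exchangeCell_left t s j w hab.ne).symm
    · congr 1
      funext j
      exact (exchangeCell_right t s j w hab.ne).symm
  · refine Finset.prod_congr rfl fun k hk => ?_
    congr 1
    funext i
    rw [Finset.mem_erase, Finset.mem_erase] at hk
    rw [Function.comp_apply, exchangeCell_of_ne t s hk.2.1 hk.1]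

variable (lam) in
/-- The filling whose entries in the `i`-th row are all equal to `i`. -/
def rowFilling : Cell lam → ℕ := fun c => c.2

variable (lam) in
theorem basisWedge_rowFilling_notMem_U : basisWedge (rowFilling lam) ∉ U lam := by
  intro h
  have hle : (U lam).toSubmodule ≤ LinearMap.ker (minorProd lam) := by
    refine Submodule.span_le.2 ?_
    rintro _ ⟨a, b, hab, m, s, w, rfl⟩
    exact minorProd_exchangeRel s hab w
  have h0 : minorProd lam (basisWedge (rowFilling lam)) = 0 := hle h
  rw [basisWedge, minorProd_wedges] at h0
  simp only [rowFilling, leadingMinor_e, Finset.prod_const_one] at h0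
  exact one_ne_zero h0

end

/-! ### The Casimir operators -/

/-- The Casimir operator `∑_{i,j<N} E_{ij} E_{ji}` of `𝔤𝔩_N`. -/
def casimir {X : Type} [AddCommGroup X] [Module ℂ X] [LieRingModule gl X] [LieModule ℂ gl X]
    (N : ℕ) : X →ₗ[ℂ] X :=
  ∑ i ∈ Finset.range N, ∑ j ∈ Finset.range N,
    (LieModule.toEnd ℂ gl X (E i j)).comp (LieModule.toEnd ℂ gl X (E j i))

theorem casimir_apply {X : Type} [AddCommGroup X] [Module ℂ X] [LieRingModule gl X]
    [LieModule ℂ gl X] (N : ℕ) (x : X) :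
    casimir N x = ∑ i ∈ Finset.range N, ∑ j ∈ Finset.range N, ⁅E i j, ⁅E j i, x⁆⁆ := by
  simp [casimir, LinearMap.sum_apply]

/-! ### The Casimir operator is a scalar modulo the exchange relations -/

section

variable {lam : YoungDiagram}

theorem exchangeCell_eq_swap {a b : Fin (lam.rowLen 0)} (t : Fin 1 ↪o Fin (lam.colLen a))
    (s : Fin 1 ↪o Fin (lam.colLen b)) :
    exchangeCell a b t s = Equiv.swap (⟨b, s 0⟩ : Cell lam) ⟨a, t 0⟩ := by
  funext c
  by_cases ha : c = ⟨a, t 0⟩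
  · subst ha
    rw [Equiv.swap_apply_right, exchangeCell,
      (Function.injective_of_subsingleton (fun r => (⟨a, t r⟩ : Cell lam))).extend_apply (a := 0)]
  rw [exchangeCell, Function.extend_apply']
  · by_cases hb : c = ⟨b, s 0⟩
    · subst hb
      rw [Equiv.swap_apply_left,
        (Function.injective_of_subsingleton (fun r => (⟨b, s r⟩ : Cell lam))).extend_apply (a := 0)]
    · rw [Function.extend_apply', Equiv.swap_apply_of_ne_of_ne hb ha, id]
      rintro ⟨r, rfl⟩
      exact hb (by rw [Subsingleton.elim r 0])
  · rintro ⟨r, rfl⟩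
    exact ha (by rw [Subsingleton.elim r 0])

theorem sum_swap_sub_mem_U {k l : Fin (lam.rowLen 0)} (hlk : l < k) (i : Fin (lam.colLen k))
    (w : Filling lam) :
    ∑ j, wedges (w ∘ Equiv.swap (⟨k, i⟩ : Cell lam) ⟨l, j⟩) - wedges w ∈ U lam := by
  let c : ∀ {n : ℕ}, Fin n → (Fin 1 ↪o Fin n) := fun j =>
    OrderEmbedding.ofStrictMono (fun _ => j) (Subsingleton.strictMono _)
  have h : exchangeRel l k (c i) w ∈ U lam :=
    Submodule.subset_span ⟨l, k, hlk, 1, c i, w, rfl⟩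
  rw [← neg_mem_iff, neg_sub]
  convert! h using 1
  rw [exchangeRel]
  congr 1
  refine Fintype.sum_bijective c ⟨fun j j' h => ?_, fun t => ⟨t 0, ?_⟩⟩ _ _ fun j => ?_
  · exact congrArg (fun t => t 0) h
  · ext r
    rw [Subsingleton.elim r 0]
    rfl
  · rw [exchangeCell_eq_swap]
    rfl

/-- For two different columns, the one-cell relations are summed over the cells of the right column,
which makes `z` its length. Inside one column each genuine transposition acts by `-1` and each
trivial one by `1`. -/
theorem exists_sum_sum_swap_sub_mem_U (k l : Fin (lam.rowLen 0)) :
    ∃ z : ℂ, ∀ w : Filling lam, ∑ i, ∑ j, wedges (w ∘ Equiv.swap (⟨k, i⟩ : Cell lam) ⟨l, j⟩) -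
      z • wedges w ∈ U lam := by
  have main : ∀ {k l : Fin (lam.rowLen 0)}, l < k → ∀ w : Filling lam,
      ∑ i, ∑ j, wedges (w ∘ Equiv.swap (⟨k, i⟩ : Cell lam) ⟨l, j⟩) -
        (lam.colLen k : ℂ) • wedges w ∈ U lam := by
    intro k l h w
    have := sum_mem fun i (_ : i ∈ Finset.univ) => sum_swap_sub_mem_U h i w
    rw [Finset.sum_sub_distrib, Finset.sum_const, Finset.card_univ, Fintype.card_fin,
      ← Nat.cast_smul_eq_nsmul ℂ] at this
    exact this
  rcases lt_trichotomy l k with h | rfl | h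
  · exact ⟨_, main h⟩
  · refine ⟨∑ i : Fin (lam.colLen l), ∑ j, if i = j then 1 else -1, fun w => ?_⟩
    rw [Finset.sum_smul, ← Finset.sum_sub_distrib]
    refine sum_mem fun i _ => ?_
    rw [Finset.sum_smul, ← Finset.sum_sub_distrib]
    refine sum_mem fun j _ => ?_
    split_ifs with h
    · subst h
      simp
    · rw [wedges_swap w h]
      simp
  · refine ⟨lam.colLen l, fun w => ?_⟩
    rw [Finset.sum_comm]
    simp only [Equiv.swap_comm (⟨k, _⟩ : Cell lam)]
    exact main h w

variable (lam) in
theorem exists_sum_swap_sub_mem_U : ∃ z : ℂ, ∀ w : Filling lam,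
    ∑ c, ∑ d, wedges (w ∘ Equiv.swap c d) - z • wedges w ∈ U lam := by
  choose z hz using exists_sum_sum_swap_sub_mem_U (lam := lam)
  refine ⟨∑ k, ∑ l, z k l, fun w => ?_⟩
  have h : ∑ k, ∑ l, (∑ i, ∑ j, wedges (w ∘ Equiv.swap (⟨k, i⟩ : Cell lam) ⟨l, j⟩) -
      z k l • wedges w) ∈ U lam :=
    Submodule.sum_mem _ fun k _ => Submodule.sum_mem _ fun l _ => hz k l w
  convert! h using 1
  simp only [Finset.sum_sub_distrib, Finset.sum_smul]
  congr 1
  rw [Fintype.sum_sigma]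
  refine Finset.sum_congr rfl fun k _ => Eq.trans ?_ Finset.sum_comm
  refine Finset.sum_congr rfl fun i _ => ?_
  rw [Fintype.sum_sigma]

/-- `E j i` turns an entry `i` in a cell `d` into `j`, and `E i j` then turns an entry `j` in a cell
`c` into `i`. If `c ≠ d`, this forces `j = w c` and exchanges the two entries. -/
theorem casimir_basisWedge {N : ℕ} {w : Cell lam → ℕ} (hw : ∀ c, w c < N) :
    casimir N (basisWedge w) = ∑ c, ∑ d, basisWedge (w ∘ Equiv.swap c d) +
      (Fintype.card (Cell lam) * (N - 1) : ℂ) • basisWedge w := by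
  -- For `c = d` all `N` values of `j` give back `w`; one copy is counted as the trivial
  -- transposition, hence the factor `N - 1`.
  have key : ∀ c d, ∑ j ∈ Finset.range N, (if Function.update w d j c = j then
      basisWedge (Function.update (Function.update w d j) c (w d)) else 0) =
      basisWedge (w ∘ Equiv.swap d c) + if d = c then (N - 1 : ℂ) • basisWedge w else 0 := by
    intro c d
    rcases eq_or_ne c d with rfl | h
    · simp only [Function.update_self, if_true, Function.update_idem, Function.update_eq_self,
        Finset.sum_const, Finset.card_range, Equiv.swap_self, Equiv.coe_refl, Function.comp_id]
      rw [← Nat.cast_smul_eq_nsmul ℂ, sub_smul, one_smul]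
      abel
    · simp only [Function.update_of_ne h, if_neg h.symm, add_zero]
      rw [Finset.sum_ite_eq, if_pos (Finset.mem_range.2 (hw c))]
      congr 1
      funext x
      simp only [Function.update_apply, Function.comp_apply, Equiv.swap_apply_def]
      split_ifs <;> simp_all
  have step : ∀ i j, ⁅E i j, ⁅E j i, basisWedge w⁆⁆ = ∑ d, if w d = i then
      ∑ c, (if Function.update w d j c = j then
        basisWedge (Function.update (Function.update w d j) c (w d)) else 0) else 0 := by
    intro i j
    rw [E_lie_basisWedge, lie_sum]
    refine Finset.sum_congr rfl fun d _ => ?_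
    split_ifs with h
    · rw [E_lie_basisWedge, h]
    · exact lie_zero _
  rw [casimir_apply]
  simp only [step]
  have : ∀ i, ∑ j ∈ Finset.range N, ∑ d, (if w d = i then
      ∑ c, (if Function.update w d j c = j then
        basisWedge (Function.update (Function.update w d j) c (w d)) else 0) else 0) =
      ∑ d, if w d = i then ∑ c, (basisWedge (w ∘ Equiv.swap d c) +
        if d = c then (N - 1 : ℂ) • basisWedge w else 0) else 0 := by
    intro i
    rw [Finset.sum_comm]
    refine Finset.sum_congr rfl fun d _ => ?_
    split_ifs with h
    · rw [Finset.sum_comm]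
      exact Finset.sum_congr rfl fun c _ => key c d
    · simp
  simp only [this]
  rw [Finset.sum_comm]
  simp only [Finset.sum_ite_eq, Finset.mem_range, hw, if_true, Finset.sum_add_distrib,
    Finset.mem_univ, Finset.sum_const, Finset.card_univ]
  rw [← Nat.cast_smul_eq_nsmul ℂ, smul_smul]

variable (lam) in
theorem exists_casimir_sub_mem_U (N : ℕ) : ∃ z : ℂ, ∀ x ∈ Submodule.span ℂ
    {x | ∃ w : Cell lam → ℕ, (∀ c, w c < N) ∧ x = basisWedge w}, casimir N x - z • x ∈ U lam := by
  obtain ⟨z, hz⟩ := exists_sum_swap_sub_mem_U lam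
  refine ⟨z + Fintype.card (Cell lam) * (N - 1), fun x hx => ?_⟩
  have hle : Submodule.span ℂ {x | ∃ w : Cell lam → ℕ, (∀ c, w c < N) ∧ x = basisWedge w} ≤
      Submodule.comap (casimir N - (z + Fintype.card (Cell lam) * (N - 1)) • LinearMap.id)
        (U lam).toSubmodule := by
    refine Submodule.span_le.2 ?_
    rintro _ ⟨w, hw, rfl⟩
    change casimir N (basisWedge w) - (z + Fintype.card (Cell lam) * (N - 1)) • basisWedge w ∈ U lam
    rw [casimir_basisWedge hw, add_smul, add_sub_add_right_eq_sub]
    exact hz fun c => e (w c)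
  exact hle hx

end

/-! ### Vectors killed by the raising operators -/

section

variable {X : Type} [AddCommGroup X] [Module ℂ X] [LieRingModule gl X] [LieModule ℂ gl X]
  {q : X} {μ : ℕ → ℕ}

/-- The eigenvalue of the Casimir operator of `𝔤𝔩_N` on a highest-weight vector of weight `μ`. -/
def casimirValue (N : ℕ) (μ : ℕ → ℕ) : ℤ :=
  ∑ i ∈ Finset.range N, ((μ i : ℤ) ^ 2 + (N - 1 - 2 * i) * μ i)

theorem sum_eq_casimirValue (N : ℕ) (μ : ℕ → ℕ) :
    ∑ i ∈ Finset.range N, ∑ j ∈ Finset.range N,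
      (if i = j then (μ i : ℤ) ^ 2 else if i < j then (μ i : ℤ) - μ j else 0) =
      casimirValue N μ := by
  rw [casimirValue]
  induction N with
  | zero => simp
  | succ N ih =>
    have h1 : ∀ i ∈ Finset.range N, ∑ j ∈ Finset.range (N + 1),
        (if i = j then (μ i : ℤ) ^ 2 else if i < j then (μ i : ℤ) - μ j else 0) =
        ∑ j ∈ Finset.range N,
          (if i = j then (μ i : ℤ) ^ 2 else if i < j then (μ i : ℤ) - μ j else 0) +
        (μ i - μ N) := by
      intro i hi
      have hi := Finset.mem_range.1 hi
      rw [Finset.sum_range_succ, if_neg hi.ne, if_pos hi]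
    have h2 : ∑ j ∈ Finset.range (N + 1),
        (if N = j then (μ N : ℤ) ^ 2 else if N < j then (μ N : ℤ) - μ j else 0) = μ N ^ 2 := by
      rw [Finset.sum_range_succ, Finset.sum_eq_zero, if_pos rfl, zero_add]
      intro j hj
      have hj := Finset.mem_range.1 hj
      rw [if_neg hj.ne', if_neg (by omega)]
    have h3 : ∑ i ∈ Finset.range N, ((μ i : ℤ) ^ 2 + (((N + 1 : ℕ) : ℤ) - 1 - 2 * i) * μ i) =
        ∑ i ∈ Finset.range N, ((μ i : ℤ) ^ 2 + (N - 1 - 2 * i) * μ i) +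
          ∑ i ∈ Finset.range N, (μ i : ℤ) := by
      rw [← Finset.sum_add_distrib]
      refine Finset.sum_congr rfl fun i _ => ?_
      push_cast
      ring
    rw [Finset.sum_range_succ, Finset.sum_congr rfl h1, h2, Finset.sum_add_distrib, ih,
      Finset.sum_range_succ, h3, Finset.sum_sub_distrib, Finset.sum_const, Finset.card_range,
      nsmul_eq_mul]
    push_cast
    ring

/-- Terms with `i > j` vanish because `E j i` raises; for `i < j` the product may be replaced by the
commutator `E i i - E j j`. -/
theorem casimir_of_raising (hraise : ∀ i j, i < j → ⁅E i j, q⁆ = 0)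
    (hwt : ∀ i, ⁅E i i, q⁆ = (μ i : ℂ) • q) (N : ℕ) :
    casimir N q = (casimirValue N μ : ℂ) • q := by
  rw [casimir_apply, ← sum_eq_casimirValue, Int.cast_sum, Finset.sum_smul]
  refine Finset.sum_congr rfl fun i _ => ?_
  rw [Int.cast_sum, Finset.sum_smul]
  refine Finset.sum_congr rfl fun j _ => ?_
  rcases lt_trichotomy i j with h | rfl | h
  · rw [if_neg h.ne, if_pos h, leibniz_lie, hraise i j h, lie_zero, add_zero, E_lie_E, if_pos rfl,
      if_pos rfl, sub_lie, hwt, hwt, ← sub_smul]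
    push_cast
    rfl
  · rw [if_pos rfl, hwt, lie_smul, hwt, smul_smul]
    push_cast
    rw [sq]
  · rw [hraise j i h, lie_zero, if_neg h.ne', if_neg (by omega), Int.cast_zero, zero_smul]

theorem E_ne_zero (i j : ℕ) : E i j ≠ 0 := by
  intro h
  have := entry_E i j i j
  rw [h] at this
  simp [entry] at this

theorem isSl2Triple {i j : ℕ} (h : i ≠ j) :
    IsSl2Triple (E i i - E j j) (E i j) (E j i) where
  h_ne_zero := by
    intro h0
    have h1 : ⁅E i i - E j j, E i j⁆ = 0 := by rw [h0, zero_lie]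
    rw [sub_lie, E_lie_E, E_lie_E] at h1
    simp only [h.symm, if_true, if_false] at h1
    have : (2 : ℂ) • E i j = 0 := by rw [two_smul, ← h1]; abel
    exact E_ne_zero i j ((smul_eq_zero.1 this).resolve_left two_ne_zero)
  lie_e_f := by rw [E_lie_E, if_pos rfl, if_pos rfl]
  lie_h_e_nsmul := by
    rw [sub_lie, E_lie_E, E_lie_E]
    simp only [h.symm, if_true, if_false, two_smul]
    abel
  lie_h_f_nsmul := by
    rw [sub_lie, E_lie_E, E_lie_E]
    simp only [h, if_true, if_false, two_smul]
    abel

/-- With `n` the last exponent for which `f ^ n` does not kill `q`, the formula e fⁿ⁺¹ q = (n+1)(μ i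
- μ j - n) fⁿ q gives `μ i - μ j = n`. -/
theorem weight_le_of_raising (hq : q ≠ 0) {i j : ℕ} (hij : i ≠ j) (hraise : ⁅E i j, q⁆ = 0)
    (hwt : ∀ i, ⁅E i i, q⁆ = (μ i : ℂ) • q)
    (hnil : ∃ n, (LieModule.toEnd ℂ gl X (E j i) ^ n) q = 0) : μ j ≤ μ i := by
  have P : (isSl2Triple hij).HasPrimitiveVectorWith q ((μ i : ℂ) - μ j) :=
    ⟨hq, by rw [sub_lie, hwt, hwt, sub_smul], hraise⟩
  obtain ⟨n, hn, hn'⟩ := Nat.exists_not_and_succ_of_not_zero_of_exists (p := fun n =>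
    (LieModule.toEnd ℂ gl X (E j i) ^ n) q = 0) (by simpa using hq) hnil
  have h := P.lie_e_pow_succ_toEnd_f n
  rw [hn', lie_zero] at h
  have h0 := (smul_eq_zero.1 h.symm).resolve_right hn
  have h1 : (μ i : ℂ) - μ j - n = 0 :=
    (mul_eq_zero.1 h0).resolve_left (by exact_mod_cast Nat.succ_ne_zero n)
  have h2 : (μ i : ℂ) = (μ j + n : ℕ) := by
    push_cast
    linear_combination h1
  have := Nat.cast_injective h2
  omega

end

/-- The Casimir value is strictly monotone for the dominance order: the difference of the two values
is `∑ (a i - b i) * g i` with `g` strictly decreasing, and summation by parts bounds it below by a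
sum of the nonnegative partial sums `D i`. -/
theorem sum_range_eq_of_casimirValue_eq {N : ℕ} {a b : ℕ → ℕ} (ha : ∀ i, a (i + 1) ≤ a i)
    (hb : ∀ i, b (i + 1) ≤ b i)
    (hdom : ∀ n, ∑ i ∈ Finset.range n, b i ≤ ∑ i ∈ Finset.range n, a i)
    (htot : ∑ i ∈ Finset.range N, b i = ∑ i ∈ Finset.range N, a i)
    (hcas : casimirValue N b = casimirValue N a) {n : ℕ} (hn : n ≤ N) :
    ∑ i ∈ Finset.range n, b i = ∑ i ∈ Finset.range n, a i := by
  let D : ℕ → ℤ := fun n => ∑ i ∈ Finset.range n, ((a i : ℤ) - b i)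
  have hD : ∀ n, D n = ((∑ i ∈ Finset.range n, a i : ℕ) : ℤ) - (∑ i ∈ Finset.range n, b i : ℕ) := by
    intro n
    simp [D, Finset.sum_sub_distrib]
  have hD0 : ∀ n, 0 ≤ D n := fun n => by
    have := hdom n
    rw [hD]
    omega
  let g : ℕ → ℤ := fun i => a i + b i + N - 1 - 2 * i
  have hg : ∀ i, g (i + 1) + 1 ≤ g i := fun i => by
    have := ha i
    have := hb i
    simp only [g]
    push_cast
    omega
  -- Abel summation, using only that `g` drops by at least `1` at each step. At `n = N` the boundary
  -- term vanishes since the totals agree.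
  have key : ∀ n, D n * g n + ∑ i ∈ Finset.range (n + 1), D i ≤
      ∑ i ∈ Finset.range n, ((a i : ℤ) - b i) * g i := by
    intro n
    induction n with
    | zero => simp [D]
    | succ n ih =>
      have h1 : D (n + 1) = D n + (a n - b n) := Finset.sum_range_succ _ _
      rw [Finset.sum_range_succ D (n + 1), Finset.sum_range_succ (fun i => ((a i : ℤ) - b i) * g i) n]
      have h2 := mul_le_mul_of_nonneg_left (hg n) (hD0 (n + 1))
      have h3 : D (n + 1) * g n = D n * g n + (a n - b n) * g n := by rw [h1]; ring
      linarith
  have hzero : ∑ i ∈ Finset.range N, ((a i : ℤ) - b i) * g i = 0 := by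
    rw [casimirValue, casimirValue] at hcas
    rw [← sub_eq_zero.2 hcas.symm, ← Finset.sum_sub_distrib]
    refine Finset.sum_congr rfl fun i _ => ?_
    simp only [g]
    ring
  have h := key N
  have hDN : D N = 0 := by rw [hD, htot, sub_self]
  rw [hzero, hDN, zero_mul, zero_add] at h
  have h0 := (Finset.sum_eq_zero_iff_of_nonneg fun i _ => hD0 i).1
    (le_antisymm h (Finset.sum_nonneg fun i _ => hD0 i)) n (Finset.mem_range.2 (by omega))
  rw [hD] at h0
  omega

/-! ### Contents of fillings -/

section

variable {lam : YoungDiagram}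

/-- The number of times that `i` occurs in a filling. -/
def content (w : Cell lam → ℕ) (i : ℕ) : ℕ := ∑ c, if w c = i then 1 else 0

theorem content_update (w : Cell lam → ℕ) (c : Cell lam) (i k : ℕ) :
    content (Function.update w c i) k + (if w c = k then 1 else 0) =
      content w k + if i = k then 1 else 0 := by
  rw [content, content, ← Finset.add_sum_erase _ _ (Finset.mem_univ c),
    ← Finset.add_sum_erase Finset.univ (fun c => if w c = k then 1 else 0) (Finset.mem_univ c),
    Function.update_self]
  have : ∑ d ∈ Finset.univ.erase c, (if Function.update w c i d = k then 1 else 0) =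
      ∑ d ∈ Finset.univ.erase c, if w d = k then 1 else 0 :=
    Finset.sum_congr rfl fun d hd => by rw [Function.update_of_ne (Finset.ne_of_mem_erase hd)]
  rw [this]
  ring

theorem content_update_congr {w w' : Cell lam → ℕ} (h : content w = content w') {c c' : Cell lam}
    (hc : w c = w' c') (i : ℕ) :
    content (Function.update w c i) = content (Function.update w' c' i) := by
  funext k
  have h1 := content_update w c i k
  have h2 := content_update w' c' i k
  rw [h, hc] at h1
  omega

theorem sum_range_content (w : Cell lam → ℕ) (n : ℕ) :
    ∑ i ∈ Finset.range n, content w i =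
      ∑ k : Fin (lam.rowLen 0), (Finset.univ.filter fun j => w ⟨k, j⟩ < n).card := by
  simp only [content]
  rw [Finset.sum_comm, Fintype.sum_sigma]
  refine Finset.sum_congr rfl fun k _ => ?_
  rw [Finset.card_filter]
  refine Finset.sum_congr rfl fun j _ => ?_
  rw [Finset.sum_ite_eq]
  simp only [Finset.mem_range]

theorem sum_range_content_eq_card {w : Cell lam → ℕ} {N : ℕ} (hw : ∀ c, w c < N) :
    ∑ i ∈ Finset.range N, content w i = Fintype.card (Cell lam) := by
  simp only [content]
  rw [Finset.sum_comm]
  simp [hw]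

theorem card_filter_fin_lt (l n : ℕ) :
    (Finset.univ.filter fun j : Fin l => (j : ℕ) < n).card = min l n := by
  rw [Fin.card_filter_val_lt]

theorem card_filter_le {l n : ℕ} {u : Fin l → ℕ} (hu : u.Injective) :
    (Finset.univ.filter fun j => u j < n).card ≤ min l n := by
  refine le_min ((Finset.card_le_univ _).trans_eq (Fintype.card_fin l)) ?_
  calc _ ≤ (Finset.range n).card := Finset.card_le_card_of_injOn u
        (fun j hj => by simpa using hj) hu.injOn
    _ = n := Finset.card_range n

theorem content_rowFilling (i : ℕ) : content (rowFilling lam) i = lam.rowLen i := by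
  rw [content, Fintype.sum_sigma]
  have h : ∀ k : Fin (lam.rowLen 0), (∑ j : Fin (lam.colLen k),
      if rowFilling lam ⟨k, j⟩ = i then 1 else 0) = if (k : ℕ) < lam.rowLen i then 1 else 0 := by
    intro k
    have hik : (k : ℕ) < lam.rowLen i ↔ i < lam.colLen k := by
      rw [← YoungDiagram.mem_iff_lt_rowLen, YoungDiagram.mem_iff_lt_colLen]
    by_cases hi : i < lam.colLen k
    · rw [if_pos (hik.2 hi), Finset.sum_eq_single ⟨i, hi⟩]
      · simp [rowFilling]
      · intro j _ hj
        exact if_neg fun h => hj (Fin.ext h)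
      · simp
    · rw [if_neg (hik.not.2 hi)]
      exact Finset.sum_eq_zero fun j _ => if_neg fun h : (j : ℕ) = i => hi (h ▸ j.2)
  rw [Finset.sum_congr rfl fun k _ => h k, ← Finset.card_filter, card_filter_fin_lt]
  exact min_eq_right (lam.rowLen_anti 0 i (Nat.zero_le i))

/-- A column of length `l` with distinct entries has at most `min l n` entries below `n`, and the
row filling attains this bound in every column. -/
theorem sum_range_content_le {w : Cell lam → ℕ}
    (hw : ∀ k : Fin (lam.rowLen 0), Function.Injective fun j => w ⟨k, j⟩) (n : ℕ) :
    ∑ i ∈ Finset.range n, content w i ≤ ∑ i ∈ Finset.range n, lam.rowLen i := by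
  simp only [← content_rowFilling]
  rw [sum_range_content, sum_range_content]
  refine Finset.sum_le_sum fun k _ => ?_
  exact (card_filter_le (hw k)).trans_eq (card_filter_fin_lt _ _).symm

/-- Equality of the sums forces equality in each column. Taking `n` to be the length of column `k`,
all entries of that column lie below its length, so they are a permutation of those of the row
filling. -/
theorem basisWedge_mem_span_of_sum_range_content_eq {w : Cell lam → ℕ}
    (hw : ∀ k : Fin (lam.rowLen 0), Function.Injective fun j => w ⟨k, j⟩)
    (h : ∀ k : Fin (lam.rowLen 0), ∑ i ∈ Finset.range (lam.colLen k), content w i =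
      ∑ i ∈ Finset.range (lam.colLen k), lam.rowLen i) :
    basisWedge w ∈ ℂ ∙ basisWedge (rowFilling lam) := by
  have hlt : ∀ (k : Fin (lam.rowLen 0)) (j : Fin (lam.colLen k)), w ⟨k, j⟩ < lam.colLen k := by
    intro k
    have h1 := h k
    simp only [← content_rowFilling] at h1
    rw [sum_range_content, sum_range_content] at h1
    have h2 := (Finset.sum_eq_sum_iff_of_le fun l _ =>
      (card_filter_le (n := lam.colLen k) (hw l)).trans_eq (card_filter_fin_lt _ _).symm).1 h1 k
      (Finset.mem_univ k)
    have h3 : (Finset.univ.filter fun j => w ⟨k, j⟩ < lam.colLen k) = Finset.univ := by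
      rw [← Finset.card_eq_iff_eq_univ, h2]
      exact (card_filter_fin_lt _ _).trans (by simp)
    intro j
    simpa using h3.ge (Finset.mem_univ j)
  let σ : ∀ k : Fin (lam.rowLen 0), Equiv.Perm (Fin (lam.colLen k)) := fun k =>
    Equiv.ofBijective (fun j => ⟨w ⟨k, j⟩, hlt k j⟩) <| Finite.injective_iff_bijective.1
      fun i j hij => hw k (congrArg Fin.val hij)
  have := wedges_comp_perm (lam := lam) (fun c => e (rowFilling lam c)) σ
  exact Submodule.mem_span_singleton.2 ⟨_, this.symm⟩

/-! ### Weight spaces -/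

variable (lam) in
/-- The space of the vectors of weight `μ`. -/
def weightSpace (μ : ℕ → ℕ) : Submodule ℂ (W lam) :=
  Submodule.span ℂ {x | ∃ w : Cell lam → ℕ, content w = μ ∧ x = basisWedge w}

variable (lam) in
theorem iSup_weightSpace : ⨆ μ, weightSpace lam μ = ⊤ := by
  rw [eq_top_iff, ← span_basisWedge lam, Submodule.span_le]
  rintro _ ⟨w, rfl⟩
  exact Submodule.mem_iSup_of_mem (content w) (Submodule.subset_span ⟨w, rfl, rfl⟩)

theorem E_lie_of_mem_weightSpace {μ : ℕ → ℕ} {x : W lam} (hx : x ∈ weightSpace lam μ) (i : ℕ) :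
    ⁅E i i, x⁆ = (μ i : ℂ) • x := by
  have hle : weightSpace lam μ ≤ LinearMap.eqLocus (LieModule.toEnd ℂ gl (W lam) (E i i))
      ((μ i : ℂ) • LinearMap.id) := by
    refine Submodule.span_le.2 ?_
    rintro _ ⟨w, rfl, rfl⟩
    change ⁅E i i, basisWedge w⁆ = (content w i : ℂ) • basisWedge w
    rw [E_lie_basisWedge, content, Nat.cast_sum, Finset.sum_smul]
    refine Finset.sum_congr rfl fun c _ => ?_
    split_ifs with h
    · rw [← h, Function.update_eq_self, Nat.cast_one, one_smul]
    · rw [Nat.cast_zero, zero_smul]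
  exact hle hx

theorem E_lie_mem_weightSpace {i j : ℕ} {w : Cell lam → ℕ} {c : Cell lam} (hc : w c = j)
    {x : W lam} (hx : x ∈ weightSpace lam (content w)) :
    ⁅E i j, x⁆ ∈ weightSpace lam (content (Function.update w c i)) := by
  have hle : weightSpace lam (content w) ≤ Submodule.comap
      (LieModule.toEnd ℂ gl (W lam) (E i j)) (weightSpace lam (content (Function.update w c i))) := by
    refine Submodule.span_le.2 ?_
    rintro _ ⟨w', hw', rfl⟩
    change ⁅E i j, basisWedge w'⁆ ∈ weightSpace lam _
    rw [E_lie_basisWedge]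
    refine Submodule.sum_mem _ fun d _ => ?_
    split_ifs with h
    · exact Submodule.subset_span ⟨_, content_update_congr hw' (h.trans hc.symm) i, rfl⟩
    · exact Submodule.zero_mem _
  exact hle hx

theorem E_lie_eq_zero {i j : ℕ} {μ : ℕ → ℕ} (hj : μ j = 0) {x : W lam}
    (hx : x ∈ weightSpace lam μ) : ⁅E i j, x⁆ = 0 := by
  have hle : weightSpace lam μ ≤ LinearMap.ker (LieModule.toEnd ℂ gl (W lam) (E i j)) := by
    refine Submodule.span_le.2 ?_
    rintro _ ⟨w, rfl, rfl⟩
    change ⁅E i j, basisWedge w⁆ = 0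
    rw [E_lie_basisWedge]
    refine Finset.sum_eq_zero fun d _ => if_neg fun h => ?_
    have := (Finset.sum_eq_zero_iff.1 hj) d (Finset.mem_univ d)
    simp [h] at this
  exact hle hx

/-- Each application of `E j i` uses up one occurrence of `i`. -/
theorem pow_E_eq_zero {i j : ℕ} (hij : i ≠ j) {μ : ℕ → ℕ} {x : W lam}
    (hx : x ∈ weightSpace lam μ) :
    (LieModule.toEnd ℂ gl (W lam) (E j i) ^ (μ i + 1)) x = 0 := by
  have h : ∀ (n : ℕ) (w : Cell lam → ℕ), content w i = n →
      (LieModule.toEnd ℂ gl (W lam) (E j i) ^ (n + 1)) (basisWedge w) = 0 := by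
    intro n
    induction n with
    | zero =>
      intro w hw
      rw [zero_add, pow_one, LieModule.toEnd_apply_apply]
      exact E_lie_eq_zero hw (Submodule.subset_span ⟨w, rfl, rfl⟩)
    | succ n ih =>
      intro w hw
      rw [pow_succ, Module.End.mul_apply, LieModule.toEnd_apply_apply, E_lie_basisWedge, map_sum]
      refine Finset.sum_eq_zero fun c _ => ?_
      split_ifs with hc
      · refine ih _ ?_
        have := content_update w c j i
        rw [if_pos hc, if_neg hij.symm] at this
        omega
      · exact map_zero _
  have hle : weightSpace lam μ ≤
      LinearMap.ker (LieModule.toEnd ℂ gl (W lam) (E j i) ^ (μ i + 1)) := by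
    refine Submodule.span_le.2 ?_
    rintro _ ⟨w, rfl, rfl⟩
    exact h _ w rfl
  exact hle hx

end

/-! ### Subquotients of `W lam` -/

section

variable {lam : YoungDiagram}

/-- Applying `E i i - μ i` to the sum removes its component of weight μ and stays in `B`, so
induction applies unless the result falls into `A`. -/
theorem exists_mem_weightSpace_of_sum {A B : LieSubmodule ℂ gl (W lam)} (n : ℕ)
    (S : Finset (ℕ → ℕ)) (hS : S.card = n) (f : (ℕ → ℕ) → W lam)
    (hf : ∀ μ ∈ S, f μ ∈ weightSpace lam μ)
    (hB : ∑ μ ∈ S, f μ ∈ B) (hA : ∑ μ ∈ S, f μ ∉ A) :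
    ∃ μ, ∃ x ∈ weightSpace lam μ, x ∈ B ∧ x ∉ A := by
  classical
  induction n generalizing S f with
  | zero =>
    rw [Finset.card_eq_zero] at hS
    subst hS
    exact (hA (by simp)).elim
  | succ n ih =>
    by_contra hcon
    have step : ∀ μ ∈ S, ∀ i, ⁅E i i, ∑ ν ∈ S, f ν⁆ - (μ i : ℂ) • ∑ ν ∈ S, f ν ∈ A := by
      intro μ hμ i
      by_contra hn
      have h1 : ⁅E i i, ∑ ν ∈ S, f ν⁆ - (μ i : ℂ) • ∑ ν ∈ S, f ν =
          ∑ ν ∈ S.erase μ, ((ν i : ℂ) - μ i) • f ν := by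
        rw [lie_sum, Finset.smul_sum, ← Finset.sum_sub_distrib, ← Finset.add_sum_erase _ _ hμ,
          E_lie_of_mem_weightSpace (hf μ hμ), sub_self, zero_add]
        refine Finset.sum_congr rfl fun ν hν => ?_
        rw [E_lie_of_mem_weightSpace (hf ν (Finset.mem_of_mem_erase hν)), sub_smul]
      refine hcon (ih (S.erase μ) (by rw [Finset.card_erase_of_mem hμ, hS, Nat.add_sub_cancel])
        (fun ν => ((ν i : ℂ) - μ i) • f ν)
        (fun ν hν => Submodule.smul_mem _ _ (hf ν (Finset.mem_of_mem_erase hν))) ?_ ?_)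
      · rw [← h1]
        exact sub_mem (LieSubmodule.lie_mem _ hB) (SMulMemClass.smul_mem _ hB)
      · rwa [← h1]
    -- Modulo `A`, each `E i i` now acts on the sum by `μ i` for every `μ` in `S`; two different
    -- weights would put the sum into `A`.
    by_cases hne : ∃ μ ∈ S, ∃ ν ∈ S, μ ≠ ν
    · obtain ⟨μ, hμ, ν, hν, hμν⟩ := hne
      obtain ⟨i, hi⟩ := Function.ne_iff.1 hμν
      have h2 := sub_mem (step μ hμ i) (step ν hν i)
      rw [sub_sub_sub_cancel_left, ← sub_smul] at h2
      have h3 : (ν i : ℂ) - μ i ≠ 0 := sub_ne_zero.2 fun h => hi (Nat.cast_injective h).symm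
      have h4 := SMulMemClass.smul_mem (S := LieSubmodule ℂ gl (W lam)) ((ν i : ℂ) - μ i)⁻¹ h2
      rw [smul_smul, inv_mul_cancel₀ h3, one_smul] at h4
      exact hA h4
    · push Not at hne
      obtain ⟨μ, hμ⟩ : S.Nonempty := Finset.card_pos.1 (by omega)
      have : S = {μ} := Finset.eq_singleton_iff_unique_mem.2 ⟨hμ, fun ν hν => hne ν hν μ hμ⟩
      subst this
      rw [Finset.sum_singleton] at hA hB
      exact hcon ⟨μ, f μ, hf μ hμ, hB, hA⟩

theorem exists_mem_weightSpace {A B : LieSubmodule ℂ gl (W lam)} {x : W lam} (hB : x ∈ B)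
    (hA : x ∉ A) : ∃ μ, ∃ x ∈ weightSpace lam μ, x ∈ B ∧ x ∉ A := by
  have hx : x ∈ ⨆ μ, weightSpace lam μ := iSup_weightSpace lam ▸ Submodule.mem_top
  obtain ⟨f, hf, rfl⟩ := (Submodule.mem_iSup_iff_exists_finsupp _ _).1 hx
  exact exists_mem_weightSpace_of_sum _ f.support rfl f (fun μ _ => hf μ) hB hA

theorem exists_raising_mem {A B : LieSubmodule ℂ gl (W lam)} {x : W lam} (hB : x ∈ B)
    (hA : x ∉ A) : ∃ w : Cell lam → ℕ, ∃ x ∈ weightSpace lam (content w),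
      x ∈ B ∧ x ∉ A ∧ ∀ i j, i < j → ⁅E i j, x⁆ ∈ A := by
  classical
  -- The sum of the entries is the quantity to minimise: for `i < j`, `E i j` replaces one entry `j`
  -- by the smaller `i`.
  let P : ℕ → Prop := fun n => ∃ w : Cell lam → ℕ, ∑ c, w c = n ∧
    ∃ x ∈ weightSpace lam (content w), x ∈ B ∧ x ∉ A
  have hP : ∃ n, P n := by
    obtain ⟨μ, y, hy, hyB, hyA⟩ := exists_mem_weightSpace hB hA
    by_cases h : ∃ w : Cell lam → ℕ, content w = μ
    · obtain ⟨w, rfl⟩ := h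
      exact ⟨_, w, rfl, y, hy, hyB, hyA⟩
    · have hle : weightSpace lam μ ≤ ⊥ := by
        refine Submodule.span_le.2 ?_
        rintro _ ⟨w, hw, rfl⟩
        exact (h ⟨w, hw⟩).elim
      have : y = 0 := hle hy
      exact (hyA (this ▸ zero_mem A)).elim
  obtain ⟨w, hw, y, hy, hyB, hyA⟩ := Nat.find_spec hP
  refine ⟨w, y, hy, hyB, hyA, fun i j hij => ?_⟩
  by_contra hn
  by_cases hc : ∃ c, w c = j
  · obtain ⟨c, hc⟩ := hc
    refine Nat.find_min hP ?_ ⟨Function.update w c i, rfl, _, E_lie_mem_weightSpace hc hy,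
      LieSubmodule.lie_mem _ hyB, hn⟩
    rw [← hw]
    refine Finset.sum_lt_sum (fun d _ => ?_) ⟨c, Finset.mem_univ c, ?_⟩
    · rcases eq_or_ne d c with rfl | h
      · rw [Function.update_self]
        omega
      · rw [Function.update_of_ne h]
    · rw [Function.update_self]
      omega
  · refine hn ?_
    rw [E_lie_eq_zero (μ := content w) _ hy]
    · exact zero_mem A
    · exact Finset.sum_eq_zero fun c _ => if_neg fun h => hc ⟨c, h⟩

/-- In the quotient by `A` the image of `x` is a nonzero highest-weight vector, on which the Casimir
operator is computed in two ways. -/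
theorem casimirValue_eq {A : LieSubmodule ℂ gl (W lam)} (hU : U lam ≤ A) {N : ℕ} {z : ℂ}
    (hz : ∀ x ∈ Submodule.span ℂ {x | ∃ w : Cell lam → ℕ, (∀ c, w c < N) ∧ x = basisWedge w},
      casimir N x - z • x ∈ U lam) {w : Cell lam → ℕ} (hw : ∀ c, w c < N) {x : W lam}
    (hx : x ∈ weightSpace lam (content w)) (hA : x ∉ A)
    (hraise : ∀ i j, i < j → ⁅E i j, x⁆ ∈ A) :
    (casimirValue N (content w) : ℂ) = z := by
  have hspan : weightSpace lam (content w) ≤ Submodule.span ℂ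
      {x | ∃ w : Cell lam → ℕ, (∀ c, w c < N) ∧ x = basisWedge w} := by
    refine Submodule.span_mono ?_
    rintro _ ⟨w', hw', rfl⟩
    refine ⟨w', fun c => ?_, rfl⟩
    by_contra hc
    have h1 : content w (w' c) = 0 :=
      Finset.sum_eq_zero fun d _ => if_neg fun h : w d = w' c => hc (h ▸ hw d)
    rw [← hw'] at h1
    have := (Finset.sum_eq_zero_iff.1 h1) c (Finset.mem_univ c)
    simp at this
  let π : W lam →ₗ⁅ℂ, gl⁆ (W lam ⧸ A) := LieSubmodule.Quotient.mk' A
  have hπ : ∀ {y : W lam}, π y = 0 ↔ y ∈ A := LieSubmodule.Quotient.mk_eq_zero A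
  have h1 : casimir N (π x) = z • π x := by
    have h2 := hπ.2 (hU (hz x (hspan hx)))
    rw [map_sub, map_smul, sub_eq_zero, casimir_apply] at h2
    rw [← h2, casimir_apply]
    simp only [map_sum, LieModuleHom.map_lie]
  have h2 : casimir N (π x) = (casimirValue N (content w) : ℂ) • π x := by
    refine casimir_of_raising (fun i j hij => ?_) (fun i => ?_) N
    · rw [← LieModuleHom.map_lie]
      exact hπ.2 (hraise i j hij)
    · rw [← LieModuleHom.map_lie, E_lie_of_mem_weightSpace hx, map_smul]
  have h3 : π x ≠ 0 := fun h => hA (hπ.1 h)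
  exact smul_left_injective ℂ h3 (h2.symm.trans h1)

variable (lam) in
theorem E_lie_basisWedge_rowFilling {i j : ℕ} (hij : i < j) :
    ⁅E i j, basisWedge (rowFilling lam)⁆ = 0 := by
  rw [E_lie_basisWedge]
  refine Finset.sum_eq_zero fun ⟨k, r⟩ _ => ?_
  split_ifs with h
  · have hr : (r : ℕ) = j := h
    have hi : i < lam.colLen k := by omega
    have hne : (⟨i, hi⟩ : Fin (lam.colLen k)) ≠ r := fun h' => by
      rw [← h'] at hr
      simp only at hr
      omega
    by_contra h0
    refine hne (injective_of_basisWedge_ne_zero h0 k ?_)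
    simp only [Function.update_self]
    rw [Function.update_of_ne (by simpa using hne)]
    rfl
  · rfl

theorem basisWedge_rowFilling_mem_sdiff {A B : LieSubmodule ℂ gl (W lam)} (hU : U lam ≤ A)
    {x₀ : W lam} (hB : x₀ ∈ B) (hA : x₀ ∉ A) :
    basisWedge (rowFilling lam) ∈ B ∧ basisWedge (rowFilling lam) ∉ A := by
  obtain ⟨w, x, hx, hxB, hxA, hraise⟩ := exists_raising_mem hB hA
  -- `N` must exceed the entries of both `w` and the row filling, so that one Casimir scalar serves
  -- for both.
  obtain ⟨N, hN⟩ : ∃ N, ∀ c, w c < N ∧ lam.colLen 0 ≤ N := by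
    refine ⟨∑ c, w c + 1 + lam.colLen 0, fun c => ⟨?_, by omega⟩⟩
    have := Finset.single_le_sum (fun c _ => Nat.zero_le (w c)) (Finset.mem_univ c)
    omega
  have hrow : ∀ c : Cell lam, lam.colLen c.1 ≤ N := fun c =>
    (lam.colLen_anti 0 c.1 (Nat.zero_le _)).trans (hN c).2
  have hrow' : ∀ c, rowFilling lam c < N := fun c => c.2.2.trans_le (hrow c)
  have hcontent : content (rowFilling lam) = lam.rowLen := funext content_rowFilling
  obtain ⟨z, hz⟩ := exists_casimir_sub_mem_U lam N
  have hcas : casimirValue N (content w) = casimirValue N lam.rowLen := by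
    have h1 := casimirValue_eq hU hz (fun c => (hN c).1) hx hxA hraise
    have h2 := casimirValue_eq le_rfl hz hrow' (Submodule.subset_span ⟨_, rfl, rfl⟩)
      (basisWedge_rowFilling_notMem_U lam) fun i j hij => by
        rw [E_lie_basisWedge_rowFilling lam hij]
        exact zero_mem _
    rw [hcontent] at h2
    exact_mod_cast h1.trans h2.symm
  have hanti : ∀ i, content w (i + 1) ≤ content w i := by
    intro i
    let π : W lam →ₗ⁅ℂ, gl⁆ (W lam ⧸ A) := LieSubmodule.Quotient.mk' A
    have hπ : ∀ {y : W lam}, π y = 0 ↔ y ∈ A := LieSubmodule.Quotient.mk_eq_zero A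
    refine weight_le_of_raising (q := π x) (fun h => hxA (hπ.1 h)) (Nat.succ_ne_self i).symm
      (by rw [← LieModuleHom.map_lie]; exact hπ.2 (hraise _ _ i.lt_succ_self))
      (fun i => by rw [← LieModuleHom.map_lie, E_lie_of_mem_weightSpace hx, map_smul])
      ⟨content w i + 1, ?_⟩
    have hpow : ∀ n (y : W lam), (LieModule.toEnd ℂ gl (W lam ⧸ A) (E (i + 1) i) ^ n) (π y) =
        π ((LieModule.toEnd ℂ gl (W lam) (E (i + 1) i) ^ n) y) := by
      intro n
      induction n with
      | zero => simp
      | succ n ih =>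
        intro y
        rw [pow_succ, pow_succ, Module.End.mul_apply, Module.End.mul_apply,
          LieModule.toEnd_apply_apply, LieModule.toEnd_apply_apply, ← LieModuleHom.map_lie, ih]
    rw [hpow, pow_E_eq_zero (Nat.succ_ne_self i).symm hx, map_zero]
  have hdom : ∀ n, ∑ i ∈ Finset.range n, content w i ≤ ∑ i ∈ Finset.range n, lam.rowLen i := by
    -- If dominance failed, every wedge of this content would have a repeated entry in a column, and
    -- the weight space would be zero.
    by_contra hcon
    have hle : weightSpace lam (content w) ≤ ⊥ := by
      refine Submodule.span_le.2 ?_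
      rintro _ ⟨w', hw', rfl⟩
      by_contra h0
      rw [← hw'] at hcon
      exact hcon (sum_range_content_le (injective_of_basisWedge_ne_zero h0))
    have : x = 0 := hle hx
    exact hxA (this ▸ zero_mem A)
  have htot : ∑ i ∈ Finset.range N, content w i = ∑ i ∈ Finset.range N, lam.rowLen i := by
    simp only [← content_rowFilling]
    rw [sum_range_content_eq_card fun c => (hN c).1, sum_range_content_eq_card hrow']
  have hle : weightSpace lam (content w) ≤ ℂ ∙ basisWedge (rowFilling lam) := by
    refine Submodule.span_le.2 ?_
    rintro _ ⟨w', hw', rfl⟩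
    by_cases h0 : basisWedge w' = 0
    · rw [h0]
      exact Submodule.zero_mem _
    · refine basisWedge_mem_span_of_sum_range_content_eq (injective_of_basisWedge_ne_zero h0)
        fun k => ?_
      rw [hw']
      rcases Nat.eq_zero_or_pos (lam.colLen k) with hk | hk
      · rw [hk]
        rfl
      · exact sum_range_eq_of_casimirValue_eq (fun i => lam.rowLen_anti _ _ i.le_succ) hanti hdom
          htot hcas (hrow ⟨k, ⟨0, hk⟩⟩)
  obtain ⟨c, rfl⟩ := Submodule.mem_span_singleton.1 (hle hx)
  have hc : c ≠ 0 := by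
    rintro rfl
    rw [zero_smul] at hxA
    exact hxA (zero_mem A)
  refine ⟨?_, fun h => hxA (SMulMemClass.smul_mem c h)⟩
  have := SMulMemClass.smul_mem (S := LieSubmodule ℂ gl (W lam)) c⁻¹ hxB
  rwa [smul_smul, inv_mul_cancel₀ hc, one_smul] at this

end

/-! ### The highest-weight vector -/

section

variable {X : Type} [AddCommGroup X] [Module ℂ X] [LieRingModule gl X] [LieModule ℂ gl X]

/-- The vectors of U(𝔫₋)v that 𝔤𝔩_∞ keeps inside U(𝔫₋)v are stable under 𝔫₋, because x f u = [x, f]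
u + f x u and [x, f] is again in 𝔤𝔩_∞. -/
theorem lie_mem_lieSpan_nMinus {v : X}
    (hv : ∀ x : gl, ⁅x, v⁆ ∈ LieSubmodule.lieSpan ℂ nMinus {v}) (x : gl) {u : X}
    (hu : u ∈ LieSubmodule.lieSpan ℂ nMinus {v}) :
    ⁅x, u⁆ ∈ LieSubmodule.lieSpan ℂ nMinus {v} := by
  set S := LieSubmodule.lieSpan ℂ nMinus {v}
  let T : LieSubmodule ℂ nMinus X :=
    { carrier := {u | u ∈ S ∧ ∀ x : gl, ⁅x, u⁆ ∈ S}
      zero_mem' := ⟨zero_mem S, fun x => by rw [lie_zero]; exact zero_mem S⟩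
      add_mem' := fun {a b} ha hb => ⟨add_mem ha.1 hb.1, fun x => by
        rw [lie_add]
        exact add_mem (ha.2 x) (hb.2 x)⟩
      smul_mem' := fun c u hu => ⟨SMulMemClass.smul_mem c hu.1, fun x => by
        rw [lie_smul]
        exact SMulMemClass.smul_mem c (hu.2 x)⟩
      lie_mem := fun {f u} hu => ⟨S.lie_mem hu.1, fun x => by
        have h1 : ⁅x, ⁅f, u⁆⁆ = ⁅⁅x, (f : gl)⁆, u⁆ + ⁅f, ⁅x, u⁆⁆ := leibniz_lie x (f : gl) u
        rw [h1]
        exact add_mem (hu.2 _) (S.lie_mem (hu.2 x))⟩ }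
  have hle : S ≤ T := LieSubmodule.lieSpan_le.2
    (Set.singleton_subset_iff.2 ⟨LieSubmodule.subset_lieSpan rfl, hv⟩)
  exact (hle hu).2 x

theorem E_mem_nMinus {i j : ℕ} (h : j < i) : E i j ∈ nMinus := by
  intro k l hkl
  rw [entry_E, ite_ne_right_iff] at hkl
  omega

theorem exists_lie_eq_sum (x : gl) : ∃ N : ℕ, (∀ i j, entry x i j ≠ 0 → i < N ∧ j < N) ∧
    ∀ v : X, ⁅x, v⁆ =
      ∑ i ∈ Finset.range N, ∑ j ∈ Finset.range N, entry x i j • ⁅E i j, v⁆ := by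
  obtain ⟨N, hN⟩ := x.2
  refine ⟨N, hN, fun v => ?_⟩
  conv_lhs => rw [eq_sum_E hN]
  simp only [sum_lie, smul_lie]

theorem isHighestWeightVector_of_isIrreducible [LieModule.IsIrreducible ℂ gl X] {v : X}
    (hv : v ≠ 0) {μ : ℕ → ℕ} (hraise : ∀ i j, i < j → ⁅E i j, v⁆ = 0)
    (hwt : ∀ i, ⁅E i i, v⁆ = (μ i : ℂ) • v) : IsHighestWeightVector X μ v where
  ne_zero := hv
  nPlus_lie x hx := by
    obtain ⟨N, -, h⟩ := exists_lie_eq_sum (X := X) x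
    rw [h]
    refine Finset.sum_eq_zero fun i _ => Finset.sum_eq_zero fun j _ => ?_
    by_cases h0 : entry x i j = 0
    · rw [h0, zero_smul]
    · rw [hraise i j (hx i j h0), smul_zero]
  cartan_lie x hx := by
    obtain ⟨N, hN, h⟩ := exists_lie_eq_sum (X := X) x
    have hsupp : Function.support (fun i => (μ i : ℂ) * entry x i i) ⊆ ↑(Finset.range N) := by
      intro i hi
      exact Finset.mem_coe.2 (Finset.mem_range.2 (hN i i (right_ne_zero_of_mul hi)).1)
    rw [h, finsum_eq_sum_of_support_subset _ hsupp, Finset.sum_smul]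
    refine Finset.sum_congr rfl fun i hi => ?_
    rw [Finset.sum_eq_single i]
    · rw [hwt, smul_smul, mul_comm]
    · intro j _ hj
      by_cases h0 : entry x i j = 0
      · rw [h0, zero_smul]
      · exact (hj (hx i j h0).symm).elim
    · exact fun h => (h hi).elim
  nMinus_span := by
    set S := LieSubmodule.lieSpan ℂ nMinus {v}
    have hvS : v ∈ S := LieSubmodule.subset_lieSpan rfl
    have hlie : ∀ x : gl, ⁅x, v⁆ ∈ S := by
      intro x
      obtain ⟨N, -, h⟩ := exists_lie_eq_sum (X := X) x
      rw [h]
      refine sum_mem fun i _ => sum_mem fun j _ => SMulMemClass.smul_mem _ ?_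
      rcases lt_trichotomy i j with hij | rfl | hij
      · rw [hraise i j hij]
        exact zero_mem S
      · rw [hwt]
        exact SMulMemClass.smul_mem _ hvS
      · exact S.lie_mem (x := ⟨E i j, E_mem_nMinus hij⟩) hvS
    let S' : LieSubmodule ℂ gl X :=
      { S.toSubmodule with lie_mem := fun {x u} hu => lie_mem_lieSpan_nMinus hlie x hu }
    have hS' : S' = ⊤ := by
      refine (IsSimpleOrder.eq_bot_or_eq_top S').resolve_left fun h => hv ?_
      have : v ∈ S' := hvS
      rwa [h, LieSubmodule.mem_bot] at this
    refine eq_top_iff.2 fun u _ => ?_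
    have : u ∈ S' := hS' ▸ LieSubmodule.mem_top u
    exact this

end

/-! ### Irreducibility of `V lam` -/

section

variable (lam : YoungDiagram)

theorem hwVector_eq :
    hwVector lam = LieSubmodule.Quotient.mk' (U lam) (basisWedge (rowFilling lam)) := rfl

theorem hwVector_ne_zero : hwVector lam ≠ 0 := fun h =>
  basisWedge_rowFilling_notMem_U lam ((LieSubmodule.Quotient.mk_eq_zero (U lam)).1 h)

/-- Let `B` be the preimage in `W lam` of a nonzero submodule. The claim for `U lam ≤ B` puts the
row filling in `B`; if `B` were proper, the claim for `B ≤ ⊤` would put it outside. -/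
theorem isIrreducible_V : LieModule.IsIrreducible ℂ gl (V lam) := by
  have : Nontrivial (V lam) := ⟨⟨_, _, hwVector_ne_zero lam⟩⟩
  refine LieModule.IsIrreducible.mk fun N hN => ?_
  let B : LieSubmodule ℂ gl (W lam) := N.comap (LieSubmodule.Quotient.mk' (U lam))
  have hUB : U lam ≤ B := by
    intro x hx
    rw [LieSubmodule.mem_comap, (LieSubmodule.Quotient.mk_eq_zero (U lam)).2 hx]
    exact zero_mem N
  obtain ⟨y, hyN, hy⟩ : ∃ y ∈ N, y ≠ 0 := by
    by_contra! h
    exact hN ((LieSubmodule.eq_bot_iff N).2 h)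
  obtain ⟨x, rfl⟩ := LieSubmodule.Quotient.surjective_mk' (U lam) y
  have h1 := basisWedge_rowFilling_mem_sdiff (B := B) le_rfl hyN
    fun h => hy ((LieSubmodule.Quotient.mk_eq_zero (U lam)).2 h)
  refine eq_top_iff.2 fun y _ => ?_
  obtain ⟨x, rfl⟩ := LieSubmodule.Quotient.surjective_mk' (U lam) y
  by_contra hx
  exact (basisWedge_rowFilling_mem_sdiff (A := B) (B := ⊤) hUB (LieSubmodule.mem_top x) hx).2 h1.1

end

end GLInf
end

theorem mainTheorem3 (lam : YoungDiagram) :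
    GLInf.IsHighestWeightVector (GLInf.V lam) lam.rowLen (GLInf.hwVector lam) ∧
      LieModule.IsIrreducible ℂ GLInf.gl (GLInf.V lam) := by
  have h := GLInf.isIrreducible_V lam
  refine ⟨GLInf.isHighestWeightVector_of_isIrreducible (GLInf.hwVector_ne_zero lam)
    (fun i j hij => ?_) (fun i => ?_), h⟩
  · rw [GLInf.hwVector_eq, ← LieModuleHom.map_lie, GLInf.E_lie_basisWedge_rowFilling lam hij,
      map_zero]
  · rw [GLInf.hwVector_eq, ← LieModuleHom.map_lie, GLInf.E_lie_of_mem_weightSpace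
      (Submodule.subset_span ⟨_, funext GLInf.content_rowFilling, rfl⟩), map_smul]
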